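/- For integers $1\le a\le n$ let $\mathcal D_{[a,n]}$ be the graph with vertices $v_a,v_{a+1},\dots,v_n$ in which $v_i$ and $v_j$ are joined if $i\mid j$ or $j\mid i$, and let $\mathcal L_{[a,n]}$ be the graph on the same vertices in which $v_i$ and $v_j$ are joined if $\operatorname{lcm}(i,j)\le n$. A function $f(a,n)$ (real-valued, on integers $1\le a\le n$) is said to depend only on the connected component of $v_a$ in $\mathcal D_{[a,n]}$ if $f(b,m)=f(b',m')$ whenever there is a graph isomorphism from the connected component of $v_b$ in $\mathcal D_{[b,m]}$ onto the connected component of $v_{b'}$ in $\mathcal D_{[b',m']}$ that maps $v_b$ to $v_{b'}$; the same definition is made for $\mathcal L$ in place of $\mathcal D$. **Theorem.** For every $\epsilon>0$ there is a constant $K=K(\epsilon)$ with the following property. Let $A\ge 0$ and let $f(a,n)$ depend only on the connected component of $v_a$ in $\mathcal D_{[a,n]}$ (respectively in $\mathcal L_{[a,n]}$) and satisfy $|f(a,n)|\le A\left(1+\log\frac na\right)$ for all $1\le a\le n$. Then the series $$C_f=\sum_{i=1}^{\infty}\ \sum_{\substack{d\ge 1\\ p\mid d\Rightarrow p\le i}}\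 \sum_{t\in[id,(i+1)d)}\left(\frac{f(d,t)}{t(t+1)}\prod_{p\le i}\frac{p-1}{p}\right)$$ (where $p$ denotes primes and $t$ integers) converges absolutely, both the sum over $d$ for each $i$ and the sum over $i$ of the resulting values, and for all $n\ge 3$ $$\left|\sum_{a=1}^n f(a,n)-nC_f\right|\le K\,A\,n\exp\left(-(1-\epsilon)\sqrt{\log n\,\log\log n}\right).$$ In particular this applies to every such $f$ with $|f(a,n)|\le A\log\frac na$, and to every such $f$ bounded by $A$. -/

import Mathlib

namespace DivLcm

/-- The divisor graph of the integer interval `[k, n]`: distinct `i`, `j` are adjacent when one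
divides the other. The self-loops carried by every vertex are immaterial for connected components
and isomorphisms, so the loopless `SimpleGraph` is used. -/
def divisorGraph (k n : ℕ) : SimpleGraph (Set.Icc k n) where
  Adj i j := i ≠ j ∧ ((i : ℕ) ∣ (j : ℕ) ∨ (j : ℕ) ∣ (i : ℕ))
  symm := ⟨fun _ _ h => ⟨h.1.symm, h.2.symm⟩⟩
  loopless := ⟨fun _ h => h.1 rfl⟩

/-- The lcm graph of the integer interval `[k, n]`: distinct `i`, `j` are adjacent when
`lcm(i, j) ≤ n` (again without the self-loops). -/
def lcmGraph (k n : ℕ) : SimpleGraph (Set.Icc k n) where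
  Adj i j := i ≠ j ∧ Nat.lcm (i : ℕ) (j : ℕ) ≤ n
  symm := ⟨fun i j h => ⟨h.1.symm, by rw [Nat.lcm_comm]; exact h.2⟩⟩
  loopless := ⟨fun _ h => h.1 rfl⟩

/-- The connected component of `v` in `G` is isomorphic, as a graph, to the connected component of
`w` in `H`, by an isomorphism that maps `v` to `w`. -/
def RootedComponentIso {V W : Type*} (G : SimpleGraph V) (v : V) (H : SimpleGraph W) (w : W) :
    Prop :=
  ∃ φ : (G.connectedComponentMk v).toSimpleGraph ≃g (H.connectedComponentMk w).toSimpleGraph,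
    φ ⟨v, SimpleGraph.ConnectedComponent.connectedComponentMk_mem⟩ =
      ⟨w, SimpleGraph.ConnectedComponent.connectedComponentMk_mem⟩

/-- For a family `G k n` of graphs on the intervals `[k, n]`: the function `f` depends only on the
connected component of the vertex `a` in `G a n`, for `1 ≤ a ≤ n`. -/
def DependsOnlyOnComponent (G : ∀ k n : ℕ, SimpleGraph (Set.Icc k n)) (f : ℕ → ℕ → ℝ) : Prop :=
  ∀ (b m b' m' : ℕ) (_ : 1 ≤ b) (hbm : b ≤ m) (_ : 1 ≤ b') (hbm' : b' ≤ m'),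
    RootedComponentIso (G b m) ⟨b, Set.left_mem_Icc.mpr hbm⟩
      (G b' m') ⟨b', Set.left_mem_Icc.mpr hbm'⟩ →
    f b m = f b' m'

/-- `∑_{t ∈ [i d, (i+1) d)} f(d, t) / (t (t + 1)) * ∏_{p ≤ i} (p - 1) / p`, `p` ranging over
primes. -/
noncomputable def seriesTerm (f : ℕ → ℕ → ℝ) (i d : ℕ) : ℝ :=
  ∑ t ∈ Finset.Ico (i * d) ((i + 1) * d),
    f d t / ((t : ℝ) * ((t : ℝ) + 1)) *
      ∏ p ∈ (Finset.Icc 1 i).filter Nat.Prime, ((p : ℝ) - 1) / (p : ℝ)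

/-- The constant `C_f`: sum over `i ≥ 1` and over the `d ≥ 1` all of whose prime factors are
at most `i` (that is, `d ∈ Nat.smoothNumbers (i + 1)`, whose prime factors are `< i + 1`). -/
noncomputable def seriesConst (f : ℕ → ℕ → ℝ) : ℝ :=
  ∑' i : ℕ+, ∑' d : Nat.smoothNumbers ((i : ℕ) + 1), seriesTerm f (i : ℕ) (d : ℕ)

end DivLcm

/-! Write `i = n / a` (integer quotient) and factor `a = d * m`, where `d` collects the primes at
most `i` and `m` the larger ones. Every neighbour of a multiple of `m` in the graph on `[a, n]` is
again a multiple of `m`, because its cofactor in the lcm is at most `i`. Dividing by `m` thus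
identifies the component of `a` with that of `d` in `[d, n / m]`, so `f (d * m) n = f d t` with `t =
n / m` (`eq_of_rough`). For fixed `t` the admissible `m` are the integers of `(n / (t + 1), n / t]`
free of primes at most `i`, and `n / a = i` means `t ∈ [i d, (i + 1) d)`. This turns the sum into a
triple sum over `i`, `d`, `t` (`sum_mainRange`). Replacing the count of `m` by its expected value `n
/ (t (t + 1)) * ∏ (1 - 1 / p)` gives `n` times the series.

The series converges because `∑ 1 / d` over the smooth `d` is the inverse of that Euler product; the
sum over `d` is therefore `O(log i / i ^ 2)`.

Put `x = log n` and `R = √(x log x)`. The error has three sources. Quotients above `y = ⌊exp R⌋`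
cost about `n / y`. Smooth parts above `D = n ^ (1 / 2 - δ)` are bounded by Rankin's trick, which
for quotients near `z` gives about `n z⁻¹ D ^ (-τ)` with a free exponent `τ`. For `d ≤ D` Brun's
pure sieve counts the `m`; its truncation error, summed over `d`, has the same shape `D ^ (-τ)` up
to lower-order factors. Choosing `z ^ τ = x ^ (1 / 2 - δ)` keeps the Euler products below `exp (δ
R)`, and then `log z + (1 / 2 - δ) ^ 2 * R ^ 2 / log z ≥ (1 - 2 δ) R` by the inequality of the means
(`LargeLog.inv_mul_rpow_le`). This is the source of the constant 1 in the exponent. -/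

namespace DivLcm

/-! ### Connected components under embeddings with closed range. -/

section Graph

variable {V W : Type*} {H : SimpleGraph V} {G : SimpleGraph W}

/-- A walk that starts in the range can never leave it, so it lifts edge by edge. -/
theorem exists_reachable_of_embedding (ψ : H ↪g G)
    (hψ : ∀ x w, G.Adj (ψ x) w → w ∈ Set.range ψ) {x w : W} (p : G.Walk x w) :
    ∀ v, ψ v = x → ∃ u, ψ u = w ∧ H.Reachable v u := by
  induction p with
  | nil => exact fun v hv => ⟨v, hv, SimpleGraph.Reachable.refl _⟩
  | cons h p ih =>
    rintro v rfl
    obtain ⟨v', rfl⟩ := hψ _ _ h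
    obtain ⟨u, hu, hr⟩ := ih v' rfl
    exact ⟨u, hu, (SimpleGraph.Adj.reachable (ψ.map_adj_iff.mp h)).trans hr⟩

/-- An embedding of graphs whose range is closed under adjacency identifies connected
components. -/
theorem rootedComponentIso_of_embedding (ψ : H ↪g G)
    (hψ : ∀ x w, G.Adj (ψ x) w → w ∈ Set.range ψ) (v : V) :
    RootedComponentIso H v G (ψ v) := by
  let g : {x // x ∈ H.connectedComponentMk v} → {w // w ∈ G.connectedComponentMk (ψ v)} :=
    fun x => ⟨ψ x.1, SimpleGraph.ConnectedComponent.eq.mpr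
      ((SimpleGraph.ConnectedComponent.eq.mp x.2).map ψ.toHom)⟩
  have hg : Function.Bijective g := by
    constructor
    · intro x x' h
      exact Subtype.ext (ψ.injective (congrArg Subtype.val h))
    · rintro ⟨w, hw⟩
      have hr : G.Reachable (ψ v) w := (SimpleGraph.ConnectedComponent.eq.mp hw).symm
      obtain ⟨u, rfl, hu⟩ := exists_reachable_of_embedding ψ hψ hr.some v rfl
      exact ⟨⟨u, SimpleGraph.ConnectedComponent.eq.mpr hu.symm⟩, rfl⟩
  refine ⟨⟨Equiv.ofBijective g hg, ?_⟩, rfl⟩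
  intro a b
  exact ψ.map_adj_iff

end Graph

/-! ### Invariance of `f` under removal of large prime factors. -/

section Scaling

variable {d m n : ℕ}

/-- Multiplication by `m`, from the interval `[d, n / m]` to the interval `[d * m, n]`. -/
def scale (hm : 0 < m) : Set.Icc d (n / m) ↪ Set.Icc (d * m) n where
  toFun x := ⟨x * m, Nat.mul_le_mul_right m x.2.1, (Nat.le_div_iff_mul_le hm).mp x.2.2⟩
  inj' _ _ h := Subtype.ext (Nat.eq_of_mul_eq_mul_right hm (congrArg Subtype.val h))

theorem coe_scale (hm : 0 < m) (x : Set.Icc d (n / m)) : (scale hm x : ℕ) = x * m := rfl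

def divisorScale (hm : 0 < m) : divisorGraph d (n / m) ↪g divisorGraph (d * m) n where
  toEmbedding := scale hm
  map_rel_iff' := by
    intro x y
    simp only [divisorGraph, ne_eq, EmbeddingLike.apply_eq_iff_eq, coe_scale,
      Nat.mul_dvd_mul_iff_right hm]

def lcmScale (hm : 0 < m) : lcmGraph d (n / m) ↪g lcmGraph (d * m) n where
  toEmbedding := scale hm
  map_rel_iff' := by
    intro x y
    simp only [lcmGraph, ne_eq, EmbeddingLike.apply_eq_iff_eq, coe_scale,
      Nat.lcm_mul_right, Nat.le_div_iff_mul_le hm]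

/-- The cofactor `k = lcm x y / y` is at most `n / a`, hence coprime to `m`. Since `m` divides `x`,
it divides `y * k`, and so `y`. -/
theorem dvd_of_lcm_le {a m n x y : ℕ} (ha : 0 < a) (hx : m ∣ x) (hx0 : 0 < x) (hy : a ≤ y)
    (hl : Nat.lcm x y ≤ n) (hm : ∀ p, p.Prime → p ∣ m → n / a < p) : m ∣ y := by
  obtain ⟨k, hk⟩ := Nat.dvd_lcm_right x y
  have hy0 : 0 < y := lt_of_lt_of_le ha hy
  have hk0 : 0 < k := by
    rcases Nat.eq_zero_or_pos k with h | h
    · rw [h, mul_zero] at hk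
      exact absurd hk (Nat.lcm_ne_zero hx0.ne' hy0.ne')
    · exact h
  have hkn : k ≤ n / a := by
    rw [Nat.le_div_iff_mul_le ha]
    calc k * a ≤ k * y := Nat.mul_le_mul_left k hy
      _ = Nat.lcm x y := by rw [hk, mul_comm]
      _ ≤ n := hl
  have hc : Nat.Coprime m k := by
    refine Nat.coprime_of_dvd fun p hp hpm hpk => ?_
    exact absurd ((Nat.le_of_dvd hk0 hpk).trans hkn) (not_le.mpr (hm p hp hpm))
  refine hc.dvd_of_dvd_mul_right ?_
  rw [← hk]
  exact hx.trans (Nat.dvd_lcm_left x y)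

/-- The lcm condition serves both graphs: adjacency in the divisor graph implies it by
`lcm_le_of_dvd_or_dvd`. -/
theorem mem_range_scale (hd : 0 < d) (hm : 0 < m)
    (hp : ∀ p, p.Prime → p ∣ m → n / (d * m) < p) (x : Set.Icc d (n / m))
    (w : Set.Icc (d * m) n) (h : Nat.lcm (scale hm x : ℕ) w ≤ n) :
    w ∈ Set.range (scale hm : Set.Icc d (n / m) ↪ Set.Icc (d * m) n) := by
  have hx : 0 < (x : ℕ) * m := Nat.mul_pos (lt_of_lt_of_le hd x.2.1) hm
  obtain ⟨c, hc⟩ : m ∣ (w : ℕ) :=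
    dvd_of_lcm_le (Nat.mul_pos hd hm) (dvd_mul_left m (x : ℕ)) hx w.2.1 h hp
  replace hc := hc.trans (mul_comm m c)
  refine ⟨⟨c, ?_, ?_⟩, Subtype.ext hc.symm⟩
  · exact Nat.le_of_mul_le_mul_right (hc ▸ w.2.1) hm
  · exact (Nat.le_div_iff_mul_le hm).mpr (hc ▸ w.2.2)

theorem lcm_le_of_dvd_or_dvd {x y : ℕ} (hx : x ≤ n) (hy : y ≤ n) (h : x ∣ y ∨ y ∣ x) :
    Nat.lcm x y ≤ n := by
  rcases h with h | h
  · rwa [Nat.lcm_eq_right h]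
  · rwa [Nat.lcm_eq_left h]

/-- The rough part of `a` may be removed without changing the value of `f`. -/
theorem eq_of_rough {f : ℕ → ℕ → ℝ} (hf : DependsOnlyOnComponent divisorGraph f ∨
    DependsOnlyOnComponent lcmGraph f) (hd : 0 < d) (hm : 0 < m) (hdm : d * m ≤ n)
    (hp : ∀ p, p.Prime → p ∣ m → n / (d * m) < p) : f (d * m) n = f d (n / m) := by
  have hdn : d ≤ n / m := (Nat.le_div_iff_mul_le hm).mpr hdm
  rcases hf with hf | hf
  · refine (hf d (n / m) (d * m) n hd hdn (Nat.mul_pos hd hm) hdm ?_).symm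
    refine rootedComponentIso_of_embedding (divisorScale hm) (fun x w h => ?_) _
    exact mem_range_scale hd hm hp x w (lcm_le_of_dvd_or_dvd (scale hm x).2.2 w.2.2 h.2)
  · refine (hf d (n / m) (d * m) n hd hdn (Nat.mul_pos hd hm) hdm ?_).symm
    refine rootedComponentIso_of_embedding (lcmScale hm) (fun x w h => ?_) _
    exact mem_range_scale hd hm hp x w h.2

end Scaling

end DivLcm

/-! ### A Chebyshev-type bound for the sum of reciprocals of primes. -/

namespace DivLcm

open Finset

/-- The sum of the reciprocals of the primes below `z`. -/
noncomputable def primeRecip (z : ℕ) : ℝ := ∑ p ∈ z.primesBelow, (p : ℝ)⁻¹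

theorem primeRecip_nonneg (z : ℕ) : 0 ≤ primeRecip z := sum_nonneg fun _ _ => by positivity

theorem primeRecip_mono {y z : ℕ} (h : y ≤ z) : primeRecip y ≤ primeRecip z := by
  refine sum_le_sum_of_subset_of_nonneg (fun p hp => ?_) fun _ _ _ => by positivity
  rw [Nat.mem_primesBelow] at hp ⊢
  exact ⟨hp.1.trans_le h, hp.2⟩

/-- The primes in `[2 ^ k, 2 ^ (k + 1))`. -/
def dyadicPrimes (k : ℕ) : Finset ℕ := {p ∈ Ico (2 ^ k) (2 ^ (k + 1)) | p.Prime}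

theorem mem_dyadicPrimes {k p : ℕ} :
    p ∈ dyadicPrimes k ↔ (2 ^ k ≤ p ∧ p < 2 ^ (k + 1)) ∧ p.Prime := by
  simp [dyadicPrimes]

/-- The product of these primes is at least `2 ^ (k * #)` and divides into a primorial that is at
most `4 ^ (2 ^ (k + 1))`. -/
theorem card_primes_dyadic (k : ℕ) :
    k * #(dyadicPrimes k) ≤ 2 ^ (k + 2) := by
  have h1 : (2 ^ k) ^ #(dyadicPrimes k) ≤
      ∏ p ∈ dyadicPrimes k, p := by
    exact pow_card_le_prod _ _ _ fun p hp => (mem_dyadicPrimes.mp hp).1.1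
  have h2 : ∏ p ∈ dyadicPrimes k, p ≤ primorial (2 ^ (k + 1)) := by
    refine prod_le_prod_of_subset_of_one_le' (fun p hp => ?_) fun p hp _ => ?_
    · rw [mem_dyadicPrimes] at hp
      simp only [mem_filter, mem_range]
      exact ⟨by omega, hp.2⟩
    · exact (mem_filter.mp hp).2.one_le
  have h3 := (h1.trans h2).trans (primorial_le_four_pow _)
  rw [← pow_mul, show (4 : ℕ) = 2 ^ 2 by norm_num, ← pow_mul] at h3
  have h4 := (Nat.pow_le_pow_iff_right (by norm_num)).mp h3
  calc _ ≤ _ := h4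
    _ = _ := by ring

/-- Each dyadic block contributes at most `4 / k`, so the total is of order `log log z`. The
constant does not matter: in the end this sum is multiplied by a power of `log n` smaller than the
square root. -/
theorem primeRecip_two_pow (k : ℕ) : primeRecip (2 ^ (k + 1)) ≤ 4 * (harmonic k : ℝ) := by
  induction k with
  | zero => simp [primeRecip, show Nat.primesBelow 2 = ∅ by decide]
  | succ k ih =>
    have hsplit : primeRecip (2 ^ (k + 1 + 1)) = primeRecip (2 ^ (k + 1)) +
        ∑ p ∈ dyadicPrimes (k + 1), (p : ℝ)⁻¹ := by
      rw [primeRecip, primeRecip, ← sum_union]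
      · refine sum_congr ?_ fun _ _ => rfl
        ext p
        simp only [Nat.mem_primesBelow, mem_union, mem_dyadicPrimes]
        have : 2 ^ (k + 1) ≤ 2 ^ (k + 1 + 1) := Nat.pow_le_pow_right (by norm_num) (by omega)
        constructor
        · rintro ⟨h, hp⟩
          by_cases h' : p < 2 ^ (k + 1)
          · exact Or.inl ⟨h', hp⟩
          · exact Or.inr ⟨⟨not_lt.mp h', h⟩, hp⟩
        · rintro (⟨h, hp⟩ | ⟨⟨_, h⟩, hp⟩)
          · exact ⟨h.trans_le this, hp⟩
          · exact ⟨h, hp⟩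
      · refine disjoint_left.mpr fun p hp hp' => ?_
        have h1 := (Nat.mem_primesBelow.mp hp).1
        have h2 := (mem_dyadicPrimes.mp hp').1.1
        omega
    have hblock : ∑ p ∈ dyadicPrimes (k + 1), (p : ℝ)⁻¹ ≤
        4 * ((k : ℝ) + 1)⁻¹ := by
      have hc : ((k + 1 : ℕ) : ℝ) *
          #(dyadicPrimes (k + 1)) ≤ 4 * 2 ^ (k + 1) := by
        have h := card_primes_dyadic (k + 1)
        have h' : ((k + 1 : ℕ) : ℝ) *
          #(dyadicPrimes (k + 1)) ≤ 2 ^ (k + 1 + 2) := by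
          exact_mod_cast h
        calc _ ≤ _ := h'
          _ = _ := by ring
      have hs : ∑ p ∈ dyadicPrimes (k + 1), (p : ℝ)⁻¹ ≤
          #(dyadicPrimes (k + 1)) • ((2 : ℝ) ^ (k + 1))⁻¹ := by
        refine sum_le_card_nsmul _ _ _ fun p hp => ?_
        have h1 := (mem_dyadicPrimes.mp hp).1.1
        have h2 : (2 : ℝ) ^ (k + 1) ≤ p := by exact_mod_cast h1
        exact inv_anti₀ (by positivity) h2
      refine hs.trans ?_
      rw [nsmul_eq_mul, ← div_eq_mul_inv, ← div_eq_mul_inv, div_le_div_iff₀ (by positivity)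
        (by positivity)]
      push_cast at hc
      linarith
    rw [harmonic_succ]
    push_cast
    rw [hsplit]
    linarith

theorem primeRecip_le {z k : ℕ} (h : z ≤ 2 ^ (k + 1)) :
    primeRecip z ≤ 4 * (1 + Real.log k) :=
  ((primeRecip_mono h).trans (primeRecip_two_pow k)).trans
    (by linarith [harmonic_le_one_add_log k])

end DivLcm

/-! ### Bonferroni inequalities and Brun's pure sieve. -/

namespace DivLcm

open Finset

theorem sum_powerset_card_lt (S : Finset ℕ) (w : ℕ) :
    ∑ T ∈ S.powerset with #T < w, (-1 : ℤ) ^ #T = ∑ j ∈ range w, (-1 : ℤ) ^ j * (#S).choose j := by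
  rw [← sum_fiberwise_of_maps_to (s := {T ∈ S.powerset | #T < w}) (t := range w)
    (g := fun T => #T) (fun T hT => mem_range.mpr (mem_filter.mp hT).2)]
  refine sum_congr rfl fun j hj => ?_
  have : {T ∈ {T ∈ S.powerset | #T < w} | #T = j} = powersetCard j S := by
    ext T
    simp only [mem_filter, mem_powerset, mem_powersetCard]
    have := mem_range.mp hj
    constructor
    · rintro ⟨⟨h, _⟩, h'⟩; exact ⟨h, h'⟩
    · rintro ⟨h, h'⟩; exact ⟨⟨h, by omega⟩, h'⟩
  rw [this, sum_congr rfl fun T hT => by rw [(mem_powersetCard.mp hT).2], sum_const,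
    card_powersetCard, nsmul_eq_mul, mul_comm]

/-- The Bonferroni inequalities. -/
theorem bonferroni (S : Finset ℕ) (w : ℕ) :
    |(if S = ∅ then 1 else 0) - ∑ T ∈ S.powerset with #T < w, (-1 : ℤ) ^ #T| ≤ (#S).choose w := by
  rw [sum_powerset_card_lt]
  rcases S.eq_empty_or_nonempty with rfl | hS
  · cases w with
    | zero => simp
    | succ w => simp [sum_range_succ']
  · obtain ⟨k, hk⟩ : ∃ k, #S = k + 1 := ⟨#S - 1, by have := hS.card_pos; omega⟩
    rw [if_neg hS.ne_empty, hk]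
    cases w with
    | zero => simp
    | succ w =>
      -- The truncated alternating sum of the row `k + 1` is `± k.choose w`, one of the two summands
      -- in Pascal's rule for `(k + 1).choose (w + 1)`.
      rw [Int.alternating_sum_range_choose_eq_choose, zero_sub, abs_neg, abs_mul, abs_pow, abs_neg,
        abs_one, one_pow, one_mul, Nat.abs_cast, Nat.choose_succ_succ]
      push_cast
      linarith [Int.natCast_nonneg (k.choose (w + 1))]

/-- The elements of `(a, b]` without prime factor below `z`. -/
def roughIoc (z a b : ℕ) : Finset ℕ := {m ∈ Ioc a b | ∀ p ∈ z.primesBelow, ¬ p ∣ m}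

/-- The density of the integers without prime factor below `z`. -/
noncomputable def roughDensity (z : ℕ) : ℝ := ∏ p ∈ z.primesBelow, (1 - (p : ℝ)⁻¹)

theorem prod_dvd_iff_subset {P T : Finset ℕ} (hP : ∀ p ∈ P, p.Prime) (hT : T ⊆ P) (m : ℕ) :
    ∏ p ∈ T, p ∣ m ↔ T ⊆ {p ∈ P | p ∣ m} := by
  constructor
  · intro h p hp
    exact mem_filter.mpr ⟨hT hp, (dvd_prod_of_mem _ hp).trans h⟩
  · intro h
    refine prod_primes_dvd m (fun p hp => (hP p (hT hp)).prime) fun p hp => ?_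
    exact (mem_filter.mp (h hp)).2

/-- Bonferroni applied for each `m` to the set of primes below `z` dividing `m`, then summed over
`m`. -/
theorem abs_card_roughIoc_sub_le (z a b w : ℕ) :
    |(#(roughIoc z a b) : ℝ) - ∑ T ∈ z.primesBelow.powerset with #T < w,
        (-1 : ℝ) ^ #T * #{m ∈ Ioc a b | ∏ p ∈ T, p ∣ m}| ≤
      ∑ T ∈ z.primesBelow.powerset with #T = w, (#{m ∈ Ioc a b | ∏ p ∈ T, p ∣ m} : ℝ) := by
  have hP : ∀ p ∈ z.primesBelow, p.Prime := fun p hp => (Nat.mem_primesBelow.mp hp).2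
  have key : ∀ m, |(if ∀ p ∈ z.primesBelow, ¬ p ∣ m then (1 : ℝ) else 0) -
      ∑ T ∈ z.primesBelow.powerset with #T < w,
        (-1 : ℝ) ^ #T * (if ∏ p ∈ T, p ∣ m then 1 else 0)| ≤
      ∑ T ∈ z.primesBelow.powerset with #T = w, (if ∏ p ∈ T, p ∣ m then (1 : ℝ) else 0) := by
    intro m
    have h := bonferroni {p ∈ z.primesBelow | p ∣ m} w
    have h1 : ({p ∈ z.primesBelow | p ∣ m} = ∅) ↔ ∀ p ∈ z.primesBelow, ¬ p ∣ m :=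
      filter_eq_empty_iff
    have h2 : ∑ T ∈ z.primesBelow.powerset with #T < w,
        (-1 : ℝ) ^ #T * (if ∏ p ∈ T, p ∣ m then 1 else 0) =
        ∑ T ∈ ({p ∈ z.primesBelow | p ∣ m} : Finset ℕ).powerset with #T < w, (-1 : ℝ) ^ #T := by
      simp only [mul_ite, mul_one, mul_zero]
      rw [← sum_filter]
      refine sum_congr ?_ fun _ _ => rfl
      ext T
      simp only [mem_filter, mem_powerset]
      constructor
      · rintro ⟨⟨h, h'⟩, h''⟩
        exact ⟨(prod_dvd_iff_subset hP h m).mp h'', h'⟩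
      · rintro ⟨h, h'⟩
        have h3 := h.trans (filter_subset _ _)
        exact ⟨⟨h3, h'⟩, (prod_dvd_iff_subset hP h3 m).mpr h⟩
    have h3 : ∑ T ∈ z.primesBelow.powerset with #T = w, (if ∏ p ∈ T, p ∣ m then (1 : ℝ) else 0) =
        (#{p ∈ z.primesBelow | p ∣ m}).choose w := by
      rw [← sum_filter, sum_const, nsmul_one, ← card_powersetCard]
      congr 2
      ext T
      simp only [mem_filter, mem_powerset, mem_powersetCard]
      constructor
      · rintro ⟨⟨h, h'⟩, h''⟩
        exact ⟨(prod_dvd_iff_subset hP h m).mp h'', h'⟩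
      · rintro ⟨h, h'⟩
        have h3 := h.trans (filter_subset _ _)
        exact ⟨⟨h3, h'⟩, (prod_dvd_iff_subset hP h3 m).mpr h⟩
    rw [h2, h3]
    simp only [h1] at h
    exact_mod_cast h
  have e1 : (#(roughIoc z a b) : ℝ) =
      ∑ m ∈ Ioc a b, if ∀ p ∈ z.primesBelow, ¬ p ∣ m then (1 : ℝ) else 0 := by
    rw [roughIoc, card_filter]
    push_cast
    rfl
  have e2 : ∀ T : Finset ℕ, (#{m ∈ Ioc a b | ∏ p ∈ T, p ∣ m} : ℝ) =
      ∑ m ∈ Ioc a b, if ∏ p ∈ T, p ∣ m then (1 : ℝ) else 0 := by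
    intro T
    rw [card_filter]
    push_cast
    rfl
  simp only [e1, e2, mul_sum]
  rw [sum_comm (t := Ioc a b), ← sum_sub_distrib, sum_comm (t := Ioc a b)]
  exact (abs_sum_le_sum_abs _ _).trans (sum_le_sum fun m _ => key m)

theorem card_Ioc_dvd {a b q : ℕ} (hab : a ≤ b) : #{m ∈ Ioc a b | q ∣ m} = b / q - a / q := by
  have h := Nat.Ioc_filter_dvd_card_eq_div b q
  have h' := Nat.Ioc_filter_dvd_card_eq_div a q
  have hd : ({m ∈ Ioc 0 b | q ∣ m} : Finset ℕ) =
      {m ∈ Ioc 0 a | q ∣ m} ∪ {m ∈ Ioc a b | q ∣ m} := by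
    ext m
    simp only [mem_filter, mem_union, mem_Ioc]
    constructor
    · rintro ⟨h1, h2⟩
      by_cases hm : m ≤ a
      · exact Or.inl ⟨⟨h1.1, hm⟩, h2⟩
      · exact Or.inr ⟨⟨by omega, h1.2⟩, h2⟩
    · rintro (⟨h1, h2⟩ | ⟨h1, h2⟩)
      · exact ⟨⟨h1.1, h1.2.trans hab⟩, h2⟩
      · exact ⟨⟨by omega, h1.2⟩, h2⟩
  have hdis : Disjoint ({m ∈ Ioc 0 a | q ∣ m} : Finset ℕ) {m ∈ Ioc a b | q ∣ m} := by
    refine disjoint_left.mpr fun m h1 h2 => ?_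
    have := (mem_Ioc.mp (mem_filter.mp h1).1).2
    have := (mem_Ioc.mp (mem_filter.mp h2).1).1
    omega
  rw [hd, card_union_of_disjoint hdis] at h
  omega

/-- The count is a difference of two floors whose fractional parts enter with opposite signs, so the
error is at most 1 rather than 2. -/
theorem abs_card_Ioc_dvd_sub_le {n t q : ℕ} (ht : 0 < t) (hq : 0 < q) :
    |(#{m ∈ Ioc (n / (t + 1)) (n / t) | q ∣ m} : ℝ) - n / (t * (t + 1)) / q| ≤ 1 := by
  have hle : n / (t + 1) ≤ n / t := Nat.div_le_div_left (by omega) ht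
  rw [card_Ioc_dvd hle, Nat.cast_sub (Nat.div_le_div_right hle), Nat.div_div_eq_div_mul,
    Nat.div_div_eq_div_mul]
  have ht' : (0 : ℝ) < t := by exact_mod_cast ht
  have hq' : (0 : ℝ) < q := by exact_mod_cast hq
  have a1 : ((n / (t * q) : ℕ) : ℝ) ≤ n / (t * q) := by
    have := @Nat.cast_div_le ℝ _ _ _ n (t * q); push_cast at this; exact this
  have b1 : ((n / ((t + 1) * q) : ℕ) : ℝ) ≤ n / ((t + 1) * q) := by
    have := @Nat.cast_div_le ℝ _ _ _ n ((t + 1) * q); push_cast at this; exact this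
  have a2 : (n : ℝ) / (t * q) < (n / (t * q) : ℕ) + 1 := by
    rw [div_lt_iff₀ (by positivity)]
    have := Nat.lt_div_mul_add (a := n) (b := t * q) (by positivity)
    have h : n < (n / (t * q) + 1) * (t * q) := by linarith
    exact_mod_cast h
  have b2 : (n : ℝ) / ((t + 1) * q) < (n / ((t + 1) * q) : ℕ) + 1 := by
    rw [div_lt_iff₀ (by positivity)]
    have := Nat.lt_div_mul_add (a := n) (b := (t + 1) * q) (by positivity)
    have h : n < (n / ((t + 1) * q) + 1) * ((t + 1) * q) := by linarith
    exact_mod_cast h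
  have e : (n : ℝ) / (t * (t + 1)) / q = n / (t * q) - n / ((t + 1) * q) := by
    field_simp
    ring
  rw [e, abs_le]
  constructor <;> linarith

theorem one_le_prod_primes {z : ℕ} {T : Finset ℕ} (hT : T ⊆ z.primesBelow) : 1 ≤ ∏ p ∈ T, p :=
  one_le_prod' fun _ hp => (Nat.mem_primesBelow.mp (hT hp)).2.one_le

theorem prod_one_add_le_exp (z : ℕ) {c : ℝ} (hc : 0 ≤ c) :
    ∑ T ∈ z.primesBelow.powerset, c ^ #T / ∏ p ∈ T, (p : ℝ) ≤ Real.exp (c * primeRecip z) := by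
  have h : ∑ T ∈ z.primesBelow.powerset, c ^ #T / ∏ p ∈ T, (p : ℝ) =
      ∏ p ∈ z.primesBelow, (1 + c * (p : ℝ)⁻¹) := by
    rw [prod_one_add]
    refine sum_congr rfl fun T _ => ?_
    rw [prod_mul_distrib, prod_const, prod_inv_distrib, div_eq_mul_inv]
  rw [h, primeRecip, mul_sum, Real.exp_sum]
  refine prod_le_prod (fun p _ => by positivity) fun p _ => ?_
  rw [add_comm]
  exact Real.add_one_le_exp _

theorem roughDensity_eq (z : ℕ) :
    roughDensity z = ∑ T ∈ z.primesBelow.powerset, (-1 : ℝ) ^ #T / ∏ p ∈ T, (p : ℝ) := by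
  have : roughDensity z = ∏ p ∈ z.primesBelow, (1 + -(p : ℝ)⁻¹) :=
    prod_congr rfl fun p _ => by ring
  rw [this, prod_one_add]
  refine sum_congr rfl fun T _ => ?_
  rw [prod_neg, prod_inv_distrib, div_eq_mul_inv]

/-- Each `T` counted satisfies `1 ≤ z ^ w / ∏ p`, and the sum of `1 / ∏ p` over all `T` is an Euler
product. -/
theorem card_powerset_card_le {z : ℕ} (hz : 0 < z) (w : ℕ) :
    (#{T ∈ z.primesBelow.powerset | #T ≤ w} : ℝ) ≤ (z : ℝ) ^ w * Real.exp (primeRecip z) := by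
  have h := prod_one_add_le_exp z zero_le_one
  simp only [one_pow, one_mul] at h
  have h2 : (#{T ∈ z.primesBelow.powerset | #T ≤ w} : ℝ) ≤
      ∑ T ∈ z.primesBelow.powerset with #T ≤ w, (z : ℝ) ^ w * (1 / ∏ p ∈ T, (p : ℝ)) := by
    rw [card_eq_sum_ones, Nat.cast_sum]
    refine sum_le_sum fun T hT => ?_
    obtain ⟨hT, hw⟩ := mem_filter.mp hT
    rw [mem_powerset] at hT
    have h0 : (0 : ℝ) < ∏ p ∈ T, (p : ℝ) :=
      prod_pos fun p hp => Nat.cast_pos.mpr (Nat.mem_primesBelow.mp (hT hp)).2.pos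
    rw [Nat.cast_one, mul_one_div, one_le_div h0]
    calc ∏ p ∈ T, (p : ℝ) ≤ ∏ p ∈ T, (z : ℝ) := by
          refine prod_le_prod (fun _ _ => by positivity) fun p hp => ?_
          exact_mod_cast (Nat.mem_primesBelow.mp (hT hp)).1.le
      _ = (z : ℝ) ^ #T := prod_const _
      _ ≤ (z : ℝ) ^ w := pow_le_pow_right₀ (by exact_mod_cast hz) hw
  refine h2.trans ?_
  rw [← mul_sum]
  refine mul_le_mul_of_nonneg_left (le_trans ?_ h) (by positivity)
  exact sum_le_sum_of_subset_of_nonneg (filter_subset _ _) fun _ _ _ => by positivity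

/-- Weighting by `c ^ (#T - w) ≥ 1` allows the sum to be extended to all `T`. The parameter `c` is
later taken to be `z ^ τ`. -/
theorem sum_powerset_le_card (z w : ℕ) {c : ℝ} (hc : 1 ≤ c) :
    ∑ T ∈ z.primesBelow.powerset with w ≤ #T, 1 / ∏ p ∈ T, (p : ℝ) ≤
      (c ^ w)⁻¹ * Real.exp (c * primeRecip z) := by
  have h := prod_one_add_le_exp z (zero_le_one.trans hc)
  have h2 : ∑ T ∈ z.primesBelow.powerset with w ≤ #T, 1 / ∏ p ∈ T, (p : ℝ) ≤
      ∑ T ∈ z.primesBelow.powerset with w ≤ #T, (c ^ w)⁻¹ * (c ^ #T / ∏ p ∈ T, (p : ℝ)) := by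
    refine sum_le_sum fun T hT => ?_
    obtain ⟨_, hw⟩ := mem_filter.mp hT
    rw [← mul_div_assoc]
    refine div_le_div_of_nonneg_right ?_ (prod_nonneg fun _ _ => by positivity)
    have h0 : 0 < c ^ w := by positivity
    rw [inv_mul_eq_div, one_le_div h0]
    exact pow_le_pow_right₀ hc hw
  refine h2.trans ?_
  rw [← mul_sum]
  refine mul_le_mul_of_nonneg_left (le_trans ?_ h) (by positivity)
  exact sum_le_sum_of_subset_of_nonneg (filter_subset _ _) fun T _ _ =>
    div_nonneg (by positivity) (prod_nonneg fun _ _ => by positivity)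

/-- Brun's pure sieve, for the interval `(n / (t + 1), n / t]`. -/
theorem brun {z n t : ℕ} (hz : 0 < z) (ht : 0 < t) (w : ℕ) {c : ℝ} (hc : 1 ≤ c) :
    |(#(roughIoc z (n / (t + 1)) (n / t)) : ℝ) - n / (t * (t + 1)) * roughDensity z| ≤
      (z : ℝ) ^ w * Real.exp (primeRecip z) +
        2 * (n / (t * (t + 1))) * ((c ^ w)⁻¹ * Real.exp (c * primeRecip z)) := by
  set X : ℝ := n / (t * (t + 1)) with hX
  have hX0 : 0 ≤ X := by positivity
  set N : Finset ℕ → ℝ := fun T => #{m ∈ Ioc (n / (t + 1)) (n / t) | ∏ p ∈ T, p ∣ m} with hN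
  have hNX : ∀ T ∈ z.primesBelow.powerset, |N T - X / ∏ p ∈ T, (p : ℝ)| ≤ 1 := by
    intro T hT
    have := abs_card_Ioc_dvd_sub_le (n := n) ht (one_le_prod_primes (mem_powerset.mp hT))
    push_cast at this
    exact this
  have h1 := abs_card_roughIoc_sub_le z (n / (t + 1)) (n / t) w
  have h2 : ∑ T ∈ z.primesBelow.powerset with #T = w, N T ≤
      ∑ T ∈ z.primesBelow.powerset with #T = w, 1 +
      X * ∑ T ∈ z.primesBelow.powerset with #T = w, 1 / ∏ p ∈ T, (p : ℝ) := by
    rw [mul_sum, ← sum_add_distrib]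
    refine sum_le_sum fun T hT => ?_
    have := (abs_le.mp (hNX T (mem_filter.mp hT).1)).2
    rw [mul_one_div]
    linarith
  -- Besides unit errors, completing the truncated sum to the full Euler product costs the terms
  -- with `w ≤ #T`. The Bonferroni remainder in `h2` costs at most the same again, whence the factor
  -- 2 in the statement.
  have h3 : |∑ T ∈ z.primesBelow.powerset with #T < w, (-1 : ℝ) ^ #T * N T -
      X * roughDensity z| ≤ ∑ T ∈ z.primesBelow.powerset with #T < w, 1 +
        X * ∑ T ∈ z.primesBelow.powerset with w ≤ #T, 1 / ∏ p ∈ T, (p : ℝ) := by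
    rw [roughDensity_eq, ← sum_filter_add_sum_filter_not z.primesBelow.powerset (fun T => #T < w),
      mul_add, ← sub_sub, mul_sum, ← sum_sub_distrib]
    refine (abs_sub _ _).trans (add_le_add ?_ ?_)
    · refine (abs_sum_le_sum_abs _ _).trans (sum_le_sum fun T hT => ?_)
      have : (-1 : ℝ) ^ #T * N T - X * ((-1 : ℝ) ^ #T / ∏ p ∈ T, (p : ℝ)) =
        (-1 : ℝ) ^ #T * (N T - X / ∏ p ∈ T, (p : ℝ)) := by ring
      rw [this, abs_mul, abs_pow, abs_neg, abs_one, one_pow, one_mul]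
      exact hNX T (mem_filter.mp hT).1
    · rw [abs_mul, abs_of_nonneg hX0]
      refine mul_le_mul_of_nonneg_left ?_ hX0
      simp only [not_lt]
      refine (abs_sum_le_sum_abs _ _).trans (sum_le_sum fun T hT => ?_)
      rw [abs_div, abs_pow, abs_neg, abs_one, one_pow,
        abs_of_nonneg (prod_nonneg fun _ _ => by positivity)]
  have h4 : ∑ T ∈ z.primesBelow.powerset with #T = w, (1 : ℝ) +
      ∑ T ∈ z.primesBelow.powerset with #T < w, 1 ≤ (z : ℝ) ^ w * Real.exp (primeRecip z) := by
    refine le_trans (le_of_eq ?_) (card_powerset_card_le hz w)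
    rw [← sum_union, sum_const, nsmul_one]
    · congr 2
      ext T
      simp only [mem_union, mem_filter]
      rw [← and_or_left]
      exact and_congr_right fun _ => by omega
    · refine disjoint_left.mpr fun T h h' => ?_
      have := (mem_filter.mp h).2
      have := (mem_filter.mp h').2
      omega
  have h5 : ∑ T ∈ z.primesBelow.powerset with #T = w, 1 / ∏ p ∈ T, (p : ℝ) ≤
      ∑ T ∈ z.primesBelow.powerset with w ≤ #T, 1 / ∏ p ∈ T, (p : ℝ) := by
    refine sum_le_sum_of_subset_of_nonneg (fun T hT => ?_) fun T _ _ =>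
      div_nonneg zero_le_one (prod_nonneg fun _ _ => by positivity)
    rw [mem_filter] at hT ⊢
    exact ⟨hT.1, hT.2.ge⟩
  have h6 := mul_le_mul_of_nonneg_left h5 hX0
  have h7 := mul_le_mul_of_nonneg_left (sum_powerset_le_card z w hc) hX0
  have h8 := abs_sub_le (#(roughIoc z (n / (t + 1)) (n / t)) : ℝ)
    (∑ T ∈ z.primesBelow.powerset with #T < w, (-1 : ℝ) ^ #T * N T) (X * roughDensity z)
  linarith

end DivLcm

/-! ### Euler products over smooth numbers and Rankin's bound. -/

namespace DivLcm

open Finset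

theorem roughDensity_nonneg (z : ℕ) : 0 ≤ roughDensity z := by
  refine prod_nonneg fun p hp => sub_nonneg.mpr (inv_le_one_of_one_le₀ ?_)
  exact_mod_cast (Nat.mem_primesBelow.mp hp).2.one_le

theorem roughDensity_le_one (z : ℕ) : roughDensity z ≤ 1 := by
  refine prod_le_one (fun p hp => sub_nonneg.mpr (inv_le_one_of_one_le₀ ?_)) fun p _ => ?_
  · exact_mod_cast (Nat.mem_primesBelow.mp hp).2.one_le
  · linarith [inv_nonneg.mpr (Nat.cast_nonneg (α := ℝ) p)]

/-- The completely multiplicative function `d ↦ d ^ (-s)`. -/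
noncomputable def rpowNegHom (s : ℝ) : ℕ →* ℝ where
  toFun d := (d : ℝ) ^ (-s)
  map_one' := by simp
  map_mul' a b := by
    rw [Nat.cast_mul, Real.mul_rpow (Nat.cast_nonneg a) (Nat.cast_nonneg b)]

theorem hasSum_smooth_rpow {s : ℝ} (hs : 0 < s) (z : ℕ) :
    HasSum (fun d : Nat.smoothNumbers z => (d : ℝ) ^ (-s))
      (∏ p ∈ z.primesBelow, (1 - (p : ℝ) ^ (-s))⁻¹) := by
  refine (EulerProduct.summable_and_hasSum_smoothNumbers_prod_primesBelow_geometric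
    (f := rpowNegHom s) (fun {p} hp => ?_) z).2
  change ‖(p : ℝ) ^ (-s)‖ < 1
  rw [Real.norm_of_nonneg (by positivity)]
  exact Real.rpow_lt_one_of_one_lt_of_neg (by exact_mod_cast hp.one_lt) (by linarith)

theorem hasSum_smooth_inv (z : ℕ) :
    HasSum (fun d : Nat.smoothNumbers z => ((d : ℕ) : ℝ)⁻¹) (roughDensity z)⁻¹ := by
  have h := hasSum_smooth_rpow one_pos z
  simp only [Real.rpow_neg_one] at h
  rwa [prod_inv_distrib] at h

theorem roughDensity_pos (z : ℕ) : 0 < roughDensity z := by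
  refine prod_pos fun p hp => sub_pos.mpr (inv_lt_one_of_one_lt₀ ?_)
  exact_mod_cast (Nat.mem_primesBelow.mp hp).2.one_lt

/-- Rankin's bound for the Euler product over the primes below `z`. -/
theorem prod_rankin_le {τ : ℝ} (h0 : 0 ≤ τ) (h1 : τ ≤ 1 / 4) (z : ℕ) :
    ∏ p ∈ z.primesBelow, (1 - (p : ℝ) ^ (-(1 - τ)))⁻¹ ≤
      Real.exp (4 * ((z : ℝ) ^ τ * primeRecip z)) := by
  rw [primeRecip, mul_sum, mul_sum, Real.exp_sum]
  -- The cap `τ ≤ 1 / 4` serves to get `x ≤ 3 / 4`, which is exactly the range in which `(1 - x)⁻¹ ≤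
  -- 1 + 4 * x` for positive `x < 1`.
  have hx : ∀ p ∈ z.primesBelow, (p : ℝ) ^ (-(1 - τ)) ≤ 3 / 4 := by
    intro p hp
    have hp2 : (2 : ℝ) ≤ p := by exact_mod_cast (Nat.mem_primesBelow.mp hp).2.two_le
    have e1 : (p : ℝ) ^ (-(1 - τ)) ≤ (2 : ℝ) ^ (-(1 - τ)) :=
      Real.rpow_le_rpow_of_nonpos (by norm_num) hp2 (by linarith)
    have e2 : (2 : ℝ) ^ (-(1 - τ)) ≤ (2 : ℝ) ^ (-(3 / 4) : ℝ) :=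
      Real.rpow_le_rpow_of_exponent_le (by norm_num) (by linarith)
    have e3 : (2 : ℝ) ^ (-(3 / 4) : ℝ) ≤ 3 / 4 := by
      refine le_of_pow_le_pow_left₀ (n := 4) (by norm_num) (by norm_num) ?_
      rw [← Real.rpow_natCast, ← Real.rpow_mul (by norm_num),
        show (-(3 / 4) : ℝ) * (4 : ℕ) = (-(3 : ℕ) : ℝ) by norm_num,
        Real.rpow_neg (by norm_num), Real.rpow_natCast]
      norm_num
    linarith
  refine prod_le_prod (fun p hp => inv_nonneg.mpr (by linarith [hx p hp])) fun p hp => ?_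
  have hp0 : (0 : ℝ) < p := by exact_mod_cast (Nat.mem_primesBelow.mp hp).2.pos
  have hpz : (p : ℝ) ≤ z := by exact_mod_cast (Nat.mem_primesBelow.mp hp).1.le
  have hx' := hx p hp
  have e : (p : ℝ) ^ (-(1 - τ)) = (p : ℝ) ^ τ * (p : ℝ)⁻¹ := by
    rw [show -(1 - τ) = τ + -1 by ring, Real.rpow_add hp0, Real.rpow_neg_one]
  have hxz : (p : ℝ) ^ (-(1 - τ)) ≤ (z : ℝ) ^ τ * (p : ℝ)⁻¹ := by
    rw [e]
    exact mul_le_mul_of_nonneg_right (Real.rpow_le_rpow hp0.le hpz h0) (by positivity)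
  have hx0 : 0 < (p : ℝ) ^ (-(1 - τ)) := by positivity
  set x := (p : ℝ) ^ (-(1 - τ))
  calc (1 - x)⁻¹ ≤ 1 + 4 * x := by
        rw [inv_le_iff_one_le_mul₀ (by linarith)]
        nlinarith
    _ ≤ Real.exp (4 * x) := by linarith [Real.add_one_le_exp (4 * x)]
    _ ≤ _ := Real.exp_le_exp.mpr (by linarith)

theorem tsum_smooth_rpow_le {τ : ℝ} (h0 : 0 ≤ τ) (h1 : τ ≤ 1 / 4) (z : ℕ) :
    ∑' d : Nat.smoothNumbers z, (d : ℝ) ^ (-(1 - τ)) ≤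
      Real.exp (4 * ((z : ℝ) ^ τ * primeRecip z)) := by
  rw [(hasSum_smooth_rpow (by linarith) z).tsum_eq]
  exact prod_rankin_le h0 h1 z

theorem sum_smooth_rpow_le {τ : ℝ} (h0 : 0 ≤ τ) (h1 : τ ≤ 1 / 4) {z : ℕ} {F : Finset ℕ}
    (hF : ∀ d ∈ F, d ∈ Nat.smoothNumbers z) :
    ∑ d ∈ F, (d : ℝ) ^ (-(1 - τ)) ≤ Real.exp (4 * ((z : ℝ) ^ τ * primeRecip z)) := by
  classical
  refine le_trans ?_ (tsum_smooth_rpow_le h0 h1 z)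
  have hs := (hasSum_smooth_rpow (s := 1 - τ) (by linarith) z).summable
  have h := hs.sum_le_tsum (F.subtype (· ∈ Nat.smoothNumbers z)) fun _ _ => by positivity
  rwa [sum_subtype_of_mem (fun d : ℕ => (d : ℝ) ^ (-(1 - τ))) hF] at h

/-- Rankin's trick. -/
theorem inv_le_rpow_of_lt {d D τ : ℝ} (hD : 0 < D) (hd : D ≤ d) (h0 : 0 ≤ τ) :
    d⁻¹ ≤ D ^ (-τ) * d ^ (-(1 - τ)) := by
  have hd0 : 0 < d := hD.trans_le hd
  rw [show -(1 - τ) = τ + -1 by ring, Real.rpow_add hd0, Real.rpow_neg_one, ← mul_assoc,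
    Real.rpow_neg hD.le]
  refine le_mul_of_one_le_left (by positivity) ?_
  rw [inv_mul_eq_div, one_le_div (by positivity)]
  exact Real.rpow_le_rpow hD.le hd h0

end DivLcm

/-! ### Smooth and rough parts, and the rearrangement of the main sum. -/

namespace DivLcm

open Finset

/-- The largest divisor of `a` all of whose prime factors are below `z`. -/
def smoothPart (z a : ℕ) : ℕ := ∏ p ∈ a.primeFactors with p < z, p ^ a.factorization p

/-- The largest divisor of `a` without prime factor below `z`. -/
def roughPart (z a : ℕ) : ℕ := ∏ p ∈ a.primeFactors with ¬ p < z, p ^ a.factorization p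

theorem smoothPart_mul_roughPart (z : ℕ) {a : ℕ} (ha : a ≠ 0) :
    smoothPart z a * roughPart z a = a := by
  rw [smoothPart, roughPart, prod_filter_mul_prod_filter_not]
  exact Nat.prod_factorization_pow_eq_self ha

theorem smoothPart_mem (z a : ℕ) : smoothPart z a ∈ Nat.smoothNumbers z := by
  rw [Nat.mem_smoothNumbers']
  intro p hp h
  obtain ⟨q, hq, hpq⟩ := (hp.prime.dvd_finsetProd_iff _).mp h
  obtain ⟨hq1, hq2⟩ := mem_filter.mp hq
  rwa [(Nat.prime_dvd_prime_iff_eq hp (Nat.prime_of_mem_primeFactors hq1)).mp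
    (hp.dvd_of_dvd_pow hpq)]

theorem le_of_dvd_roughPart {z a p : ℕ} (hp : p.Prime) (h : p ∣ roughPart z a) : z ≤ p := by
  obtain ⟨q, hq, hpq⟩ := (hp.prime.dvd_finsetProd_iff _).mp h
  obtain ⟨hq1, hq2⟩ := mem_filter.mp hq
  rw [(Nat.prime_dvd_prime_iff_eq hp (Nat.prime_of_mem_primeFactors hq1)).mp
    (hp.dvd_of_dvd_pow hpq)]
  exact not_lt.mp hq2

theorem smoothPart_dvd_smoothPart {y z : ℕ} (h : y ≤ z) (a : ℕ) :
    smoothPart y a ∣ smoothPart z a := by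
  refine prod_dvd_prod_of_subset _ _ _ fun p hp => ?_
  rw [mem_filter] at hp ⊢
  exact ⟨hp.1, hp.2.trans_le h⟩

theorem coprime_of_smooth_rough {z d m : ℕ} (hd : d ∈ Nat.smoothNumbers z)
    (hm : ∀ p, p.Prime → p ∣ m → z ≤ p) : Nat.Coprime d m :=
  Nat.coprime_of_dvd fun p hp h h' =>
    absurd (Nat.mem_smoothNumbers'.mp hd p hp h) (not_lt.mpr (hm p hp h'))

/-- Uniqueness of the factorization: each of the two smooth factors is coprime to the other's rough
cofactor, so each divides the other. -/
theorem smoothPart_mul {z d m : ℕ} (hd : d ∈ Nat.smoothNumbers z) (hm0 : m ≠ 0)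
    (hm : ∀ p, p.Prime → p ∣ m → z ≤ p) : smoothPart z (d * m) = d := by
  have hd0 := Nat.ne_zero_of_mem_smoothNumbers hd
  have h := smoothPart_mul_roughPart z (mul_ne_zero hd0 hm0)
  refine Nat.dvd_antisymm ?_ ?_
  · refine (coprime_of_smooth_rough (smoothPart_mem z (d * m)) hm).dvd_of_dvd_mul_right ?_
    exact ⟨_, h.symm⟩
  · refine (coprime_of_smooth_rough hd
      (fun p hp => le_of_dvd_roughPart (a := d * m) hp)).dvd_of_dvd_mul_right ?_
    rw [h]
    exact dvd_mul_right d m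

theorem roughPart_mul {z d m : ℕ} (hd : d ∈ Nat.smoothNumbers z) (hm0 : m ≠ 0)
    (hm : ∀ p, p.Prime → p ∣ m → z ≤ p) : roughPart z (d * m) = m := by
  have hd0 := Nat.ne_zero_of_mem_smoothNumbers hd
  have h := smoothPart_mul_roughPart z (mul_ne_zero hd0 hm0)
  rw [smoothPart_mul hd hm0 hm] at h
  exact Nat.eq_of_mul_eq_mul_left (Nat.pos_of_ne_zero hd0) h

open Classical in
/-- The `d ≤ min n D` all of whose prime factors are below `z`. -/
noncomputable def smoothUpTo (z n : ℕ) (D : ℝ) : Finset ℕ :=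
  {d ∈ Icc 1 n | d ∈ Nat.smoothNumbers z ∧ (d : ℝ) ≤ D}

theorem mem_smoothUpTo {z n d : ℕ} {D : ℝ} : d ∈ smoothUpTo z n D ↔
    (1 ≤ d ∧ d ≤ n) ∧ d ∈ Nat.smoothNumbers z ∧ (d : ℝ) ≤ D := by
  classical
  rw [smoothUpTo, mem_filter, mem_Icc]

open Classical in
/-- The `a ≤ n` with `n / a ≤ y` whose smooth part is at most `D`. -/
noncomputable def mainRange (n y : ℕ) (D : ℝ) : Finset ℕ :=
  {a ∈ Icc 1 n | n / a ≤ y ∧ (smoothPart (n / a + 1) a : ℝ) ≤ D}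

theorem mem_mainRange {n y a : ℕ} {D : ℝ} : a ∈ mainRange n y D ↔
    (1 ≤ a ∧ a ≤ n) ∧ n / a ≤ y ∧ (smoothPart (n / a + 1) a : ℝ) ≤ D := by
  classical
  rw [mainRange, mem_filter, mem_Icc]

theorem mem_roughIoc_iff {z n t m : ℕ} (ht : 0 < t) :
    m ∈ roughIoc z (n / (t + 1)) (n / t) ↔
      (0 < m ∧ n / m = t) ∧ ∀ p, p.Prime → p ∣ m → z ≤ p := by
  have h1 : (n / (t + 1) < m ∧ m ≤ n / t) ↔ (0 < m ∧ n / m = t) := by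
    rw [Nat.div_lt_iff_lt_mul (by omega), Nat.le_div_iff_mul_le ht]
    constructor
    · rintro ⟨h, h'⟩
      have hm : 0 < m := Nat.pos_of_ne_zero fun h0 => by simp [h0] at h
      refine ⟨hm, ?_⟩
      rw [Nat.div_eq_iff hm]
      constructor
      · rw [mul_comm] at h'; exact h'
      · have : t * m + m = m * (t + 1) := by ring
        omega
    · rintro ⟨hm, h⟩
      rw [Nat.div_eq_iff hm] at h
      have : t * m + m = m * (t + 1) := by ring
      constructor
      · omega
      · rw [mul_comm]; exact h.1
  rw [roughIoc, mem_filter, mem_Ioc, h1]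
  refine and_congr_right fun _ => ?_
  simp only [Nat.mem_primesBelow]
  constructor
  · intro h p hp hpm
    by_contra hz
    exact h p ⟨not_le.mp hz, hp⟩ hpm
  · intro h p hp hpm
    exact absurd hp.1 (not_lt.mpr (h p hp.2 hpm))

/-- The exact identity behind the theorem. The threshold `i + 1` makes `d` carry the primes at most
`i = n / a`, so the primes of `m` exceed `n / (d * m)`, as `eq_of_rough` requires. -/
theorem sum_mainRange {f : ℕ → ℕ → ℝ} (hf : DependsOnlyOnComponent divisorGraph f ∨
    DependsOnlyOnComponent lcmGraph f) (n y : ℕ) (D : ℝ) :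
    ∑ a ∈ mainRange n y D, f a n =
      ∑ i ∈ Icc 1 y, ∑ d ∈ smoothUpTo (i + 1) n D, ∑ t ∈ Ico (i * d) ((i + 1) * d),
        f d t * #(roughIoc (i + 1) (n / (t + 1)) (n / t)) := by
  have hc : ∀ (c : ℝ) (s : Finset ℕ), c * #s = ∑ _m ∈ s, c := fun c s => by
    rw [sum_const, nsmul_eq_mul, mul_comm]
  simp only [hc, sum_sigma']
  symm
  have facts : ∀ i d t m : ℕ, i ∈ Icc 1 y → d ∈ smoothUpTo (i + 1) n D →
      t ∈ Ico (i * d) ((i + 1) * d) → m ∈ roughIoc (i + 1) (n / (t + 1)) (n / t) →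
      0 < m ∧ n / m = t ∧ n / (d * m) = i ∧ d * m ≤ n ∧ ∀ p, p.Prime → p ∣ m → i + 1 ≤ p := by
    intro i d t m hi hd ht hm
    have hi1 := (mem_Icc.mp hi).1
    have hd1 := (mem_smoothUpTo.mp hd).1.1
    rw [mem_Ico] at ht
    have ht0 : 0 < t := lt_of_lt_of_le (Nat.mul_pos hi1 hd1) ht.1
    obtain ⟨⟨hm0, hmt⟩, hp⟩ := (mem_roughIoc_iff ht0).mp hm
    have hdiv : n / (d * m) = i := by
      rw [mul_comm, ← Nat.div_div_eq_div_mul, hmt, Nat.div_eq_iff hd1]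
      have : (i + 1) * d = i * d + d := by ring
      omega
    refine ⟨hm0, hmt, hdiv, ?_, hp⟩
    by_contra h
    rw [Nat.div_eq_of_lt (not_le.mp h)] at hdiv
    omega
  -- The bijection sends `(i, d, t, m)` to `a = d * m`; its inverse reads off `i = n / a`, the two
  -- parts of `a`, and `t = n / m`.
  refine sum_nbij' (fun x => x.2.1 * x.2.2.2)
    (fun a => ⟨n / a, smoothPart (n / a + 1) a, n / roughPart (n / a + 1) a,
      roughPart (n / a + 1) a⟩) ?_ ?_ ?_ ?_ ?_
  · rintro ⟨i, d, t, m⟩ hx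
    simp only [mem_sigma] at hx
    obtain ⟨hi, hd, ht, hm⟩ := hx
    obtain ⟨hm0, hmt, hdiv, hle, hp⟩ := facts i d t m hi hd ht hm
    have hd' := mem_smoothUpTo.mp hd
    simp only [mem_mainRange, hdiv, smoothPart_mul hd'.2.1 hm0.ne' hp]
    exact ⟨⟨Nat.mul_pos hd'.1.1 hm0, hle⟩, (mem_Icc.mp hi).2, hd'.2.2⟩
  · intro a ha
    obtain ⟨⟨ha1, han⟩, hy, hD⟩ := mem_mainRange.mp ha
    have hprod := smoothPart_mul_roughPart (n / a + 1) (a := a) (by omega)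
    have hi : 1 ≤ n / a := (Nat.one_le_div_iff ha1).mpr han
    have hs := smoothPart_mem (n / a + 1) a
    have hr := fun (p : ℕ) (hp : p.Prime) => le_of_dvd_roughPart (z := n / a + 1) (a := a) hp
    generalize smoothPart (n / a + 1) a = d at *
    generalize roughPart (n / a + 1) a = m at *
    have hd0 : 0 < d := Nat.pos_of_ne_zero (Nat.ne_zero_of_mem_smoothNumbers hs)
    have hm0 : 0 < m := Nat.pos_of_ne_zero fun h => by subst h; omega
    have hdiv : n / m / d = n / a := by rw [Nat.div_div_eq_div_mul, mul_comm, hprod]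
    have ht : n / m ∈ Ico (n / a * d) ((n / a + 1) * d) := by
      rw [Nat.div_eq_iff hd0] at hdiv
      rw [mem_Ico]
      have : (n / a + 1) * d = n / a * d + d := by ring
      omega
    have ht0 : 0 < n / m := lt_of_lt_of_le (Nat.mul_pos hi hd0) (mem_Ico.mp ht).1
    simp only [mem_sigma]
    refine ⟨mem_Icc.mpr ⟨hi, hy⟩, mem_smoothUpTo.mpr ⟨⟨hd0, ?_⟩, hs, hD⟩, ht,
      (mem_roughIoc_iff ht0).mpr ⟨⟨hm0, rfl⟩, hr⟩⟩
    exact (Nat.le_of_dvd ha1 ⟨m, hprod.symm⟩).trans han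
  · rintro ⟨i, d, t, m⟩ hx
    simp only [mem_sigma] at hx
    obtain ⟨hi, hd, ht, hm⟩ := hx
    obtain ⟨hm0, hmt, hdiv, hle, hp⟩ := facts i d t m hi hd ht hm
    have hd' := mem_smoothUpTo.mp hd
    simp only [hdiv, smoothPart_mul hd'.2.1 hm0.ne' hp, roughPart_mul hd'.2.1 hm0.ne' hp, hmt]
  · intro a ha
    exact smoothPart_mul_roughPart _ (by have := (mem_mainRange.mp ha).1.1; omega)
  · rintro ⟨i, d, t, m⟩ hx
    simp only [mem_sigma] at hx
    obtain ⟨hi, hd, ht, hm⟩ := hx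
    obtain ⟨hm0, hmt, hdiv, hle, hp⟩ := facts i d t m hi hd ht hm
    have hd' := mem_smoothUpTo.mp hd
    have := eq_of_rough hf hd'.1.1 hm0 hle (fun p hp' h => by rw [hdiv]; exact hp p hp' h)
    simp only [this, hmt]

end DivLcm

/-! ### Absolute convergence of the series and estimates of its tails. -/

namespace DivLcm

open Finset

section Bounds

variable {f : ℕ → ℕ → ℝ} {A : ℝ}

theorem nonneg_of_bound
    (hb : ∀ a n : ℕ, 1 ≤ a → a ≤ n → |f a n| ≤ A * (1 + Real.log ((n : ℝ) / (a : ℝ)))) :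
    0 ≤ A := by
  have h := hb 1 1 le_rfl le_rfl
  simp only [Nat.cast_one, div_one, Real.log_one, add_zero, mul_one] at h
  exact (abs_nonneg _).trans h

theorem abs_le_log
    (hb : ∀ a n : ℕ, 1 ≤ a → a ≤ n → |f a n| ≤ A * (1 + Real.log ((n : ℝ) / (a : ℝ))))
    {a n : ℕ} (ha : 1 ≤ a) (han : a ≤ n) : |f a n| ≤ A * (1 + Real.log n) := by
  refine (hb a n ha han).trans (mul_le_mul_of_nonneg_left ?_ (nonneg_of_bound hb))
  have ha' : (1 : ℝ) ≤ a := by exact_mod_cast ha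
  have hn' : (0 : ℝ) < n := by exact_mod_cast ha.trans han
  have := Real.log_le_log (by positivity) (div_le_self hn'.le ha')
  linarith

theorem abs_le_of_mem_Ico
    (hb : ∀ a n : ℕ, 1 ≤ a → a ≤ n → |f a n| ≤ A * (1 + Real.log ((n : ℝ) / (a : ℝ))))
    {i d t : ℕ} (hi : 1 ≤ i) (hd : 1 ≤ d) (ht : t ∈ Ico (i * d) ((i + 1) * d)) :
    |f d t| ≤ A * (1 + Real.log (i + 1)) := by
  rw [mem_Ico] at ht
  have hdt : d ≤ t := (Nat.le_mul_of_pos_left d hi).trans ht.1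
  refine (hb d t hd hdt).trans (mul_le_mul_of_nonneg_left ?_ (nonneg_of_bound hb))
  have hd' : (0 : ℝ) < d := by exact_mod_cast hd
  have ht' : (0 : ℝ) < t := by exact_mod_cast hd.trans hdt
  have h : (t : ℝ) / d ≤ i + 1 := by
    rw [div_le_iff₀ hd']
    exact_mod_cast ht.2.le
  have := Real.log_le_log (by positivity) h
  linarith

theorem sum_Ico_le {i d : ℕ} (hi : 1 ≤ i) (hd : 1 ≤ d) :
    ∑ t ∈ Ico (i * d) ((i + 1) * d), 1 / ((t : ℝ) * ((t : ℝ) + 1)) ≤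
      ((i : ℝ) ^ 2)⁻¹ * (d : ℝ)⁻¹ := by
  have hi' : (0 : ℝ) < i := by exact_mod_cast hi
  have hd' : (0 : ℝ) < d := by exact_mod_cast hd
  have h := sum_le_card_nsmul (Ico (i * d) ((i + 1) * d))
    (fun t : ℕ => 1 / ((t : ℝ) * ((t : ℝ) + 1))) (1 / ((i : ℝ) * d) ^ 2) fun t ht => by
      have h1 : (i : ℝ) * d ≤ t := by exact_mod_cast (mem_Ico.mp ht).1
      have h0 : 0 < (i : ℝ) * d := by positivity
      refine one_div_le_one_div_of_le (by positivity) ?_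
      nlinarith
  refine h.trans (le_of_eq ?_)
  rw [Nat.card_Ico, nsmul_eq_mul, show (i + 1) * d - i * d = d by
    rw [add_mul, one_mul, Nat.add_sub_cancel_left]]
  field_simp

theorem prod_Icc_prime (i : ℕ) :
    ∏ p ∈ (Icc 1 i).filter Nat.Prime, ((p : ℝ) - 1) / (p : ℝ) = roughDensity (i + 1) := by
  have hs : (Icc 1 i).filter Nat.Prime = (i + 1).primesBelow := by
    ext p
    simp only [mem_filter, mem_Icc, Nat.mem_primesBelow]
    constructor
    · rintro ⟨h, hp⟩; exact ⟨by omega, hp⟩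
    · rintro ⟨h, hp⟩; exact ⟨⟨hp.one_le, by omega⟩, hp⟩
  rw [hs, roughDensity]
  refine prod_congr rfl fun p hp => ?_
  have : (p : ℝ) ≠ 0 := by exact_mod_cast (Nat.mem_primesBelow.mp hp).2.ne_zero
  field_simp

theorem seriesTerm_eq (f : ℕ → ℕ → ℝ) (i d : ℕ) : seriesTerm f i d =
    ∑ t ∈ Ico (i * d) ((i + 1) * d), f d t * (1 / (t * (t + 1)) * roughDensity (i + 1)) := by
  rw [seriesTerm, prod_Icc_prime]
  refine sum_congr rfl fun t _ => by ring

theorem abs_seriesTerm_le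
    (hb : ∀ a n : ℕ, 1 ≤ a → a ≤ n → |f a n| ≤ A * (1 + Real.log ((n : ℝ) / (a : ℝ))))
    {i d : ℕ} (hi : 1 ≤ i) (hd : 1 ≤ d) :
    |seriesTerm f i d| ≤
      A * (1 + Real.log (i + 1)) * ((i : ℝ) ^ 2)⁻¹ * roughDensity (i + 1) * (d : ℝ)⁻¹ := by
  rw [seriesTerm_eq]
  have hV := roughDensity_nonneg (i + 1)
  have hlog : 0 ≤ Real.log ((i : ℝ) + 1) := Real.log_nonneg (by linarith [Nat.cast_nonneg (α := ℝ) i])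
  have hA := nonneg_of_bound hb
  calc _ ≤ ∑ t ∈ Ico (i * d) ((i + 1) * d), A * (1 + Real.log (i + 1)) *
        roughDensity (i + 1) * (1 / ((t : ℝ) * (t + 1))) := by
        refine (abs_sum_le_sum_abs _ _).trans (sum_le_sum fun t ht => ?_)
        rw [abs_mul, abs_of_nonneg (mul_nonneg (by positivity) hV : 0 ≤
          1 / ((t : ℝ) * (t + 1)) * roughDensity (i + 1))]
        refine (mul_le_mul_of_nonneg_right (abs_le_of_mem_Ico hb hi hd ht)
          (mul_nonneg (by positivity) hV)).trans (le_of_eq (by ring))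
    _ ≤ A * (1 + Real.log (i + 1)) * roughDensity (i + 1) * (((i : ℝ) ^ 2)⁻¹ * (d : ℝ)⁻¹) := by
        rw [← mul_sum]
        exact mul_le_mul_of_nonneg_left (sum_Ico_le hi hd) (by positivity)
    _ = _ := by ring

theorem one_le_smooth {z : ℕ} (d : Nat.smoothNumbers z) : 1 ≤ (d : ℕ) :=
  Nat.one_le_iff_ne_zero.mpr (Nat.ne_zero_of_mem_smoothNumbers d.2)

/-- The density factor cancels the sum of `1 / d` over smooth `d`, so no factor depending on the
Euler product remains. -/
theorem hasSum_majorant (i : ℕ) (c : ℝ) :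
    HasSum (fun d : Nat.smoothNumbers (i + 1) => c * roughDensity (i + 1) * ((d : ℕ) : ℝ)⁻¹) c := by
  have h := (hasSum_smooth_inv (i + 1)).mul_left (c * roughDensity (i + 1))
  rwa [mul_assoc, mul_inv_cancel₀ (roughDensity_pos _).ne', mul_one] at h

theorem summable_seriesTerm
    (hb : ∀ a n : ℕ, 1 ≤ a → a ≤ n → |f a n| ≤ A * (1 + Real.log ((n : ℝ) / (a : ℝ))))
    {i : ℕ} (hi : 1 ≤ i) :
    Summable fun d : Nat.smoothNumbers (i + 1) => seriesTerm f i d :=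
  Summable.of_norm_bounded (hasSum_majorant i _).summable fun d =>
    abs_seriesTerm_le hb hi (one_le_smooth d)

theorem abs_tsum_seriesTerm_le
    (hb : ∀ a n : ℕ, 1 ≤ a → a ≤ n → |f a n| ≤ A * (1 + Real.log ((n : ℝ) / (a : ℝ))))
    {i : ℕ} (hi : 1 ≤ i) :
    |∑' d : Nat.smoothNumbers (i + 1), seriesTerm f i d| ≤
      A * (1 + Real.log (i + 1)) * ((i : ℝ) ^ 2)⁻¹ := by
  rw [← Real.norm_eq_abs]
  exact tsum_of_norm_bounded (hasSum_majorant i _) fun d =>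
    abs_seriesTerm_le hb hi (one_le_smooth d)

/-- The terms with large `d` are negligible. -/
theorem abs_tsum_sub_sum_smoothUpTo_le
    (hb : ∀ a n : ℕ, 1 ≤ a → a ≤ n → |f a n| ≤ A * (1 + Real.log ((n : ℝ) / (a : ℝ))))
    {i n : ℕ} (hi : 1 ≤ i) {D τ : ℝ} (hD : 0 < D) (hDn : D ≤ n) (h0 : 0 ≤ τ) (h1 : τ ≤ 1 / 4) :
    |∑' d : Nat.smoothNumbers (i + 1), seriesTerm f i d -
        ∑ d ∈ smoothUpTo (i + 1) n D, seriesTerm f i d| ≤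
      A * (1 + Real.log (i + 1)) * ((i : ℝ) ^ 2)⁻¹ *
        (D ^ (-τ) * Real.exp (4 * (((i + 1 : ℕ) : ℝ) ^ τ * primeRecip (i + 1)))) := by
  classical
  set B := A * (1 + Real.log (i + 1)) * ((i : ℝ) ^ 2)⁻¹ with hB
  have hlog : 0 ≤ Real.log ((i : ℝ) + 1) := Real.log_nonneg (by linarith [Nat.cast_nonneg (α := ℝ) i])
  have hA := nonneg_of_bound hb
  have hB0 : 0 ≤ B := by positivity
  -- The terms cut off at `D`, written over the same index type so that the two series can be
  -- subtracted. As `D ≤ n`, the condition `d ≤ n` in `smoothUpTo` is automatic.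
  let g : Nat.smoothNumbers (i + 1) → ℝ := fun d => if (d : ℝ) ≤ D then seriesTerm f i d else 0
  have hgs : HasSum g (∑ d ∈ smoothUpTo (i + 1) n D, seriesTerm f i d) := by
    have h : HasSum g _ := hasSum_sum_of_ne_finset_zero
      (s := (smoothUpTo (i + 1) n D).subtype (· ∈ Nat.smoothNumbers (i + 1))) fun d hd => by
        have hd' : ¬ (d : ℝ) ≤ D := by
          intro h
          refine hd (mem_subtype.mpr (mem_smoothUpTo.mpr ⟨⟨one_le_smooth d, ?_⟩, d.2, h⟩))
          exact_mod_cast h.trans hDn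
        exact if_neg hd'
    have e : ∑ d ∈ (smoothUpTo (i + 1) n D).subtype (· ∈ Nat.smoothNumbers (i + 1)), g d =
        ∑ d ∈ smoothUpTo (i + 1) n D, seriesTerm f i d := by
      rw [← sum_subtype_of_mem (fun d => seriesTerm f i d) fun d hd => (mem_smoothUpTo.mp hd).2.1]
      refine sum_congr rfl fun d hd => if_pos (mem_smoothUpTo.mp (mem_subtype.mp hd)).2.2
    rwa [e] at h
  have hs := summable_seriesTerm hb hi
  rw [← hgs.tsum_eq, ← hs.tsum_sub hgs.summable, ← Real.norm_eq_abs]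
  have hm := ((hasSum_smooth_rpow (s := 1 - τ) (by linarith) (i + 1)).mul_left (B * D ^ (-τ)))
  refine (tsum_of_norm_bounded hm fun d => ?_).trans ?_
  · by_cases hd : (d : ℝ) ≤ D
    · simp only [g, if_pos hd, sub_self, norm_zero]
      positivity
    · simp only [g, if_neg hd, sub_zero]
      have h3 := inv_le_rpow_of_lt hD (not_le.mp hd).le h0
      calc _ ≤ B * roughDensity (i + 1) * ((d : ℕ) : ℝ)⁻¹ :=
            abs_seriesTerm_le hb hi (one_le_smooth d)
        _ ≤ B * 1 * (D ^ (-τ) * (d : ℝ) ^ (-(1 - τ))) := by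
            gcongr
            exact roughDensity_le_one _
        _ = _ := by ring
  · rw [mul_assoc]
    exact mul_le_mul_of_nonneg_left (mul_le_mul_of_nonneg_left (prod_rankin_le h0 h1 _)
      (by positivity)) hB0

theorem log_div_sq_le {δ : ℝ} (h0 : 0 < δ) (h1 : δ ≤ 1) {i : ℕ} (hi : 1 ≤ i) :
    (1 + Real.log (i + 1)) * ((i : ℝ) ^ 2)⁻¹ ≤ (1 + 2 / δ) * (i : ℝ) ^ (-(2 - δ)) := by
  have hi' : (1 : ℝ) ≤ i := by exact_mod_cast hi
  have e1 : Real.log ((i : ℝ) + 1) ≤ 2 / δ * (i : ℝ) ^ δ := by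
    have h := Real.log_le_rpow_div (x := (i : ℝ) + 1) (by positivity) h0
    have h2 : ((i : ℝ) + 1) ^ δ ≤ 2 * (i : ℝ) ^ δ := by
      calc ((i : ℝ) + 1) ^ δ ≤ (2 * (i : ℝ)) ^ δ :=
            Real.rpow_le_rpow (by positivity) (by linarith) h0.le
        _ = (2 : ℝ) ^ δ * (i : ℝ) ^ δ := Real.mul_rpow (by norm_num) (by positivity)
        _ ≤ 2 * (i : ℝ) ^ δ := by
            refine mul_le_mul_of_nonneg_right ?_ (by positivity)
            calc (2 : ℝ) ^ δ ≤ (2 : ℝ) ^ (1 : ℝ) :=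
                  Real.rpow_le_rpow_of_exponent_le (by norm_num) h1
              _ = 2 := Real.rpow_one 2
    calc _ ≤ _ := h
      _ ≤ 2 * (i : ℝ) ^ δ / δ := div_le_div_of_nonneg_right h2 h0.le
      _ = _ := by ring
  have e2 : (1 : ℝ) ≤ (i : ℝ) ^ δ := Real.one_le_rpow hi' h0.le
  have e3 : (i : ℝ) ^ (-(2 - δ)) = (i : ℝ) ^ δ * ((i : ℝ) ^ 2)⁻¹ := by
    rw [show -(2 - δ) = δ + -(2 : ℕ) by push_cast; ring, Real.rpow_add (by positivity),
      Real.rpow_neg (by positivity) ((2 : ℕ) : ℝ), Real.rpow_natCast]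
  rw [e3, ← mul_assoc]
  refine mul_le_mul_of_nonneg_right ?_ (by positivity)
  linarith

/-- The sum of the series `∑ n ^ (-(1 + δ))`, starting from `n = 1`. -/
noncomputable def zetaAt (δ : ℝ) : ℝ := ∑' k : ℕ, ((k + 1 : ℕ) : ℝ) ^ (-(1 + δ))

theorem summable_zetaAt {δ : ℝ} (h0 : 0 < δ) :
    Summable fun k : ℕ => ((k + 1 : ℕ) : ℝ) ^ (-(1 + δ)) :=
  (summable_nat_add_iff (f := fun k : ℕ => (k : ℝ) ^ (-(1 + δ))) 1).mpr
    (Real.summable_nat_rpow.mpr (by linarith))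

/-- The exponent `2 - δ` splits as `(1 - 2 * δ) + (1 + δ)`: the first part yields the decay in `y`,
the second a convergent sum over `k`. -/
theorem abs_term_le {δ : ℝ} (h0 : 0 < δ) (h1 : δ ≤ 1 / 4) {g : ℕ → ℝ} (hA : 0 ≤ A)
    (hg : ∀ i, 1 ≤ i → |g i| ≤ A * (1 + Real.log (i + 1)) * ((i : ℝ) ^ 2)⁻¹) (y k : ℕ) :
    |g (k + y + 1)| ≤ A * (1 + 2 / δ) * ((y + 1 : ℕ) : ℝ) ^ (-(1 - 2 * δ)) *
      ((k + 1 : ℕ) : ℝ) ^ (-(1 + δ)) := by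
  have h := hg (k + y + 1) (by omega)
  have h2 := log_div_sq_le h0 (by linarith) (i := k + y + 1) (by omega)
  have hy : (0 : ℝ) < ((y + 1 : ℕ) : ℝ) := by positivity
  have hk : (0 : ℝ) < ((k + 1 : ℕ) : ℝ) := by positivity
  calc _ ≤ _ := h
    _ = A * ((1 + Real.log ((k + y + 1 : ℕ) + 1)) * (((k + y + 1 : ℕ) : ℝ) ^ 2)⁻¹) := by ring
    _ ≤ A * ((1 + 2 / δ) * ((k + y + 1 : ℕ) : ℝ) ^ (-(2 - δ))) :=
        mul_le_mul_of_nonneg_left h2 hA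
    _ = A * (1 + 2 / δ) * (((k + y + 1 : ℕ) : ℝ) ^ (-(1 - 2 * δ)) *
          ((k + y + 1 : ℕ) : ℝ) ^ (-(1 + δ))) := by
        rw [← Real.rpow_add (by positivity)]
        ring_nf
    _ ≤ A * (1 + 2 / δ) * (((y + 1 : ℕ) : ℝ) ^ (-(1 - 2 * δ)) *
          ((k + 1 : ℕ) : ℝ) ^ (-(1 + δ))) := by
        refine mul_le_mul_of_nonneg_left ?_ (by positivity)
        refine mul_le_mul ?_ ?_ (by positivity) (by positivity)
        · exact Real.rpow_le_rpow_of_nonpos hy (by exact_mod_cast (by omega)) (by linarith)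
        · exact Real.rpow_le_rpow_of_nonpos hk (by exact_mod_cast (by omega)) (by linarith)
    _ = _ := by ring

theorem summable_of_log_div_sq {g : ℕ → ℝ} (hA : 0 ≤ A)
    (hg : ∀ i, 1 ≤ i → |g i| ≤ A * (1 + Real.log (i + 1)) * ((i : ℝ) ^ 2)⁻¹) :
    Summable fun k : ℕ => g (k + 1) := by
  have h4 : (0 : ℝ) < 1 / 4 := by norm_num
  refine Summable.of_norm_bounded ((summable_zetaAt h4).mul_left _)
    fun k => abs_term_le h4 le_rfl hA hg 0 k

theorem abs_tsum_sub_sum_Icc_le {δ : ℝ} (h0 : 0 < δ) (h1 : δ ≤ 1 / 4) {g : ℕ → ℝ} (hA : 0 ≤ A)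
    (hg : ∀ i, 1 ≤ i → |g i| ≤ A * (1 + Real.log (i + 1)) * ((i : ℝ) ^ 2)⁻¹) (y : ℕ) :
    |∑' i : ℕ+, g i - ∑ i ∈ Icc 1 y, g i| ≤
      A * (1 + 2 / δ) * ((y + 1 : ℕ) : ℝ) ^ (-(1 - 2 * δ)) * zetaAt δ := by
  have hs := summable_of_log_div_sq hA hg
  rw [tsum_pnat_eq_tsum_succ (f := g), ← hs.sum_add_tsum_nat_add y]
  have e : ∑ i ∈ Icc 1 y, g i = ∑ k ∈ range y, g (k + 1) := by
    rw [range_eq_Ico, sum_Ico_add' g 0 y 1]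
    rfl
  rw [e, add_sub_cancel_left, ← Real.norm_eq_abs]
  exact tsum_of_norm_bounded ((summable_zetaAt h0).hasSum.mul_left _)
    fun k => abs_term_le h0 h1 hA hg y k

end Bounds

end DivLcm

/-! ### Exceptional `a`: large quotient or large smooth part. -/

namespace DivLcm

open Finset

theorem card_quotient_gt_le (n y : ℕ) : (#{a ∈ Icc 1 n | y < n / a} : ℝ) ≤ n / ((y + 1 : ℕ) : ℝ) := by
  have h : #{a ∈ Icc 1 n | y < n / a} ≤ n / (y + 1) := by
    calc _ ≤ #(Icc 1 (n / (y + 1))) := by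
          refine card_le_card fun a ha => ?_
          obtain ⟨h1, h2⟩ := mem_filter.mp ha
          have ha1 := (mem_Icc.mp h1).1
          refine mem_Icc.mpr ⟨ha1, (Nat.le_div_iff_mul_le (by omega)).mpr ?_⟩
          have := (Nat.le_div_iff_mul_le ha1).mp h2
          rwa [mul_comm]
      _ = _ := by simp
  calc (#{a ∈ Icc 1 n | y < n / a} : ℝ) ≤ ((n / (y + 1) : ℕ) : ℝ) := by exact_mod_cast h
    _ ≤ _ := Nat.cast_div_le

open Classical in
-- Such an `a` is a multiple of its smooth part `d > D`; there are at most `N / d` multiples, and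
-- Rankin's trick sums `1 / d`.
theorem card_smoothPart_gt_le {D τ : ℝ} (hD : 0 < D) (h0 : 0 ≤ τ) (h1 : τ ≤ 1 / 4) (z N : ℕ) :
    (#{a ∈ Icc 1 N | D < (smoothPart z a : ℝ)} : ℝ) ≤
      N * (D ^ (-τ) * Real.exp (4 * ((z : ℝ) ^ τ * primeRecip z))) := by
  set F : Finset ℕ := {d ∈ Icc 1 N | d ∈ Nat.smoothNumbers z ∧ D < (d : ℝ)} with hF
  have hsub : ({a ∈ Icc 1 N | D < (smoothPart z a : ℝ)} : Finset ℕ) ⊆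
      F.biUnion fun d => {a ∈ Ioc 0 N | d ∣ a} := by
    intro a ha
    obtain ⟨ha1, ha2⟩ := mem_filter.mp ha
    rw [mem_Icc] at ha1
    have hdvd : smoothPart z a ∣ a := ⟨_, (smoothPart_mul_roughPart z (by omega)).symm⟩
    have hs := smoothPart_mem z a
    refine mem_biUnion.mpr ⟨smoothPart z a, mem_filter.mpr ⟨mem_Icc.mpr ⟨?_, ?_⟩, hs, ha2⟩,
      mem_filter.mpr ⟨mem_Ioc.mpr ⟨by omega, ha1.2⟩, hdvd⟩⟩
    · exact Nat.one_le_iff_ne_zero.mpr (Nat.ne_zero_of_mem_smoothNumbers hs)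
    · exact (Nat.le_of_dvd (by omega) hdvd).trans ha1.2
  have hcard : (#{a ∈ Icc 1 N | D < (smoothPart z a : ℝ)} : ℝ) ≤ ∑ d ∈ F, ((N / d : ℕ) : ℝ) := by
    have h := (card_le_card hsub).trans card_biUnion_le
    simp only [Nat.Ioc_filter_dvd_card_eq_div] at h
    exact_mod_cast h
  refine hcard.trans ?_
  calc ∑ d ∈ F, ((N / d : ℕ) : ℝ) ≤ ∑ d ∈ F, N * (D ^ (-τ) * (d : ℝ) ^ (-(1 - τ))) := by
        refine sum_le_sum fun d hd => ?_
        refine (Nat.cast_div_le).trans ?_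
        rw [div_eq_mul_inv]
        exact mul_le_mul_of_nonneg_left (inv_le_rpow_of_lt hD (mem_filter.mp hd).2.2.le h0)
          (Nat.cast_nonneg N)
    _ = N * (D ^ (-τ) * ∑ d ∈ F, (d : ℝ) ^ (-(1 - τ))) := by rw [mul_sum, mul_sum]
    _ ≤ _ := by
        refine mul_le_mul_of_nonneg_left (mul_le_mul_of_nonneg_left ?_ (by positivity))
          (Nat.cast_nonneg N)
        exact sum_smooth_rpow_le h0 h1 fun d hd => (mem_filter.mp hd).2.1

open Classical in
/-- Few `a ≤ n` have a large smooth part. -/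
theorem card_large_smoothPart_le {n y : ℕ} (hy : 1 ≤ y) (hyn : y ≤ n) {D Q U : ℝ} {τ : ℕ → ℝ}
    (hD : 0 < D)
    (hτ : ∀ z, 2 ≤ z → z ≤ 2 * y → (0 ≤ τ z ∧ τ z ≤ 1 / 4) ∧
      Real.exp (4 * ((z : ℝ) ^ τ z * primeRecip z)) ≤ U ∧ (z : ℝ)⁻¹ * D ^ (-τ z) ≤ Q) :
    (#{a ∈ Icc 1 n | n / a ≤ y ∧ D < (smoothPart (n / a + 1) a : ℝ)} : ℝ) ≤
      (1 + 2 * Real.log n) * (2 * n * (Q * U)) := by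
  set S : Finset ℕ := {a ∈ Icc 1 n | n / a ≤ y ∧ D < (smoothPart (n / a + 1) a : ℝ)} with hS
  -- The quotients `n / a` are cut into dyadic blocks `[2 ^ j, 2 ^ (j + 1))`. In a block `a ≤ n / 2
  -- ^ j`, and smooth parts only grow when the threshold is raised to `z = 2 ^ (j + 1)`, which may
  -- reach `2 * y`.
  have hmaps : ∀ a ∈ S, Nat.log 2 (n / a) ∈ range (Nat.log 2 y + 1) := fun a ha =>
    mem_range.mpr (Nat.lt_succ_of_le (Nat.log_mono_right (mem_filter.mp ha).2.1))
  have hblock : ∀ j ∈ range (Nat.log 2 y + 1),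
      (#{a ∈ S | Nat.log 2 (n / a) = j} : ℝ) ≤ 2 * n * (Q * U) := by
    intro j hj
    have hj' : 2 ^ j ≤ y :=
      (Nat.pow_le_pow_right (by norm_num) (Nat.le_of_lt_succ (mem_range.mp hj))).trans
        (Nat.pow_log_le_self 2 (by omega))
    have hz2 : 2 ≤ 2 ^ (j + 1) := by rw [pow_succ]; have := Nat.one_le_two_pow (n := j); omega
    have hzy : 2 ^ (j + 1) ≤ 2 * y := by rw [pow_succ]; omega
    obtain ⟨⟨h0, h1⟩, hU, hQ⟩ := hτ _ hz2 hzy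
    have hsub : ({a ∈ S | Nat.log 2 (n / a) = j} : Finset ℕ) ⊆
        {a ∈ Icc 1 (n / 2 ^ j) | D < (smoothPart (2 ^ (j + 1)) a : ℝ)} := by
      intro a ha
      obtain ⟨haS, hlog⟩ := mem_filter.mp ha
      obtain ⟨ha1, ha2, ha3⟩ := mem_filter.mp haS
      rw [mem_Icc] at ha1
      have hna : n / a ≠ 0 := by
        have := (Nat.one_le_div_iff (by omega)).mpr ha1.2
        omega
      have hlo := Nat.pow_log_le_self 2 hna
      have hhi := Nat.lt_pow_succ_log_self (b := 2) (by norm_num) (n / a)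
      rw [hlog] at hlo hhi
      refine mem_filter.mpr ⟨mem_Icc.mpr ⟨ha1.1, ?_⟩, ha3.trans_le ?_⟩
      · rw [Nat.le_div_iff_mul_le (by positivity), mul_comm]
        exact (Nat.le_div_iff_mul_le (by omega)).mp hlo
      · have hle := Nat.le_of_dvd (Nat.pos_of_ne_zero
          (Nat.ne_zero_of_mem_smoothNumbers (smoothPart_mem (2 ^ (j + 1)) a)))
          (smoothPart_dvd_smoothPart (show n / a + 1 ≤ 2 ^ (j + 1) by omega) a)
        exact_mod_cast hle
    have hcard := card_smoothPart_gt_le hD h0 h1 (2 ^ (j + 1)) (n / 2 ^ j)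
    have hcard' : (#{a ∈ S | Nat.log 2 (n / a) = j} : ℝ) ≤
      (#{a ∈ Icc 1 (n / 2 ^ j) | D < (smoothPart (2 ^ (j + 1)) a : ℝ)} : ℝ) := by
      exact_mod_cast card_le_card hsub
    have hdiv : ((n / 2 ^ j : ℕ) : ℝ) ≤ 2 * n * ((2 ^ (j + 1) : ℕ) : ℝ)⁻¹ := by
      refine (Nat.cast_div_le).trans (le_of_eq ?_)
      push_cast
      rw [pow_succ]
      field_simp
    calc _ ≤ _ := hcard'
      _ ≤ _ := hcard
      _ ≤ (2 * n * ((2 ^ (j + 1) : ℕ) : ℝ)⁻¹) * (D ^ (-τ (2 ^ (j + 1))) * U) := by gcongr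
      _ = 2 * n * ((((2 ^ (j + 1) : ℕ) : ℝ)⁻¹ * D ^ (-τ (2 ^ (j + 1)))) * U) := by ring
      _ ≤ _ := by
          have : 0 ≤ U := (Real.exp_pos _).le.trans hU
          gcongr
  have hcard := card_eq_sum_card_fiberwise hmaps
  have hn : (1 : ℝ) ≤ n := by exact_mod_cast hy.trans hyn
  have hlog : (Nat.log 2 y : ℝ) ≤ 2 * Real.log n := by
    have h1 : ((2 : ℝ) ^ Nat.log 2 y) ≤ n := by
      exact_mod_cast (Nat.pow_log_le_self 2 (by omega)).trans hyn
    have h2 := Real.log_le_log (by positivity) h1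
    rw [Real.log_pow] at h2
    have h3 : (1 : ℝ) / 2 ≤ Real.log 2 := by linarith [Real.log_two_gt_d9]
    nlinarith [Nat.cast_nonneg (α := ℝ) (Nat.log 2 y)]
  have hnn : 0 ≤ 2 * n * (Q * U) :=
    (Nat.cast_nonneg _).trans (hblock 0 (mem_range.mpr (Nat.succ_pos _)))
  rw [hcard]
  push_cast
  calc _ ≤ ∑ j ∈ range (Nat.log 2 y + 1), 2 * n * (Q * U) := sum_le_sum hblock
    _ = ((Nat.log 2 y : ℝ) + 1) * (2 * n * (Q * U)) := by
        rw [sum_const, card_range, nsmul_eq_mul]; push_cast; ring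
    _ ≤ _ := mul_le_mul_of_nonneg_right (by linarith) hnn

theorem abs_sum_sub_sum_mainRange_le {f : ℕ → ℕ → ℝ} {A : ℝ}
    (hb : ∀ a n : ℕ, 1 ≤ a → a ≤ n → |f a n| ≤ A * (1 + Real.log ((n : ℝ) / (a : ℝ))))
    {n y : ℕ} (hy : 1 ≤ y) (hyn : y ≤ n) {D Q U : ℝ} {τ : ℕ → ℝ} (hD : 0 < D)
    (hτ : ∀ z, 2 ≤ z → z ≤ 2 * y → (0 ≤ τ z ∧ τ z ≤ 1 / 4) ∧
      Real.exp (4 * ((z : ℝ) ^ τ z * primeRecip z)) ≤ U ∧ (z : ℝ)⁻¹ * D ^ (-τ z) ≤ Q) :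
    |∑ a ∈ Icc 1 n, f a n - ∑ a ∈ mainRange n y D, f a n| ≤
      A * (1 + Real.log n) * (n / ((y + 1 : ℕ) : ℝ) +
        (1 + 2 * Real.log n) * (2 * n * (Q * U))) := by
  classical
  have hA := nonneg_of_bound hb
  have hn : (1 : ℝ) ≤ n := by exact_mod_cast hy.trans hyn
  have hlog := Real.log_nonneg hn
  have hsub : mainRange n y D ⊆ Icc 1 n := filter_subset _ _
  rw [← sum_sdiff hsub, add_sub_cancel_right]
  have hcover : Icc 1 n \ mainRange n y D ⊆ {a ∈ Icc 1 n | y < n / a} ∪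
      {a ∈ Icc 1 n | n / a ≤ y ∧ D < (smoothPart (n / a + 1) a : ℝ)} := by
    intro a ha
    rw [mem_sdiff, mem_mainRange] at ha
    rw [mem_union, mem_filter, mem_filter]
    by_cases hya : y < n / a
    · exact Or.inl ⟨ha.1, hya⟩
    · refine Or.inr ⟨ha.1, not_lt.mp hya, ?_⟩
      by_contra h
      exact ha.2 ⟨mem_Icc.mp ha.1, not_lt.mp hya, not_lt.mp h⟩
  have hcard : (#(Icc 1 n \ mainRange n y D) : ℝ) ≤ n / ((y + 1 : ℕ) : ℝ) +
      (1 + 2 * Real.log n) * (2 * n * (Q * U)) := by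
    have h := (card_le_card hcover).trans (card_union_le _ _)
    have h' : (#(Icc 1 n \ mainRange n y D) : ℝ) ≤ (#{a ∈ Icc 1 n | y < n / a} : ℝ) +
      (#{a ∈ Icc 1 n | n / a ≤ y ∧ D < (smoothPart (n / a + 1) a : ℝ)} : ℝ) := by
      exact_mod_cast h
    have h1 := card_quotient_gt_le n y
    have h2 := card_large_smoothPart_le hy hyn hD hτ
    linarith
  calc _ ≤ ∑ a ∈ Icc 1 n \ mainRange n y D, |f a n| := abs_sum_le_sum_abs _ _
    _ ≤ ∑ a ∈ Icc 1 n \ mainRange n y D, A * (1 + Real.log n) := by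
        refine sum_le_sum fun a ha => ?_
        have := mem_Icc.mp (mem_sdiff.mp ha).1
        exact abs_le_log hb this.1 this.2
    _ = A * (1 + Real.log n) * #(Icc 1 n \ mainRange n y D) := by
        rw [sum_const, nsmul_eq_mul, mul_comm]
    _ ≤ _ := mul_le_mul_of_nonneg_left hcard (by positivity)

end DivLcm

/-! ### Choice of the sieve level and the total sieve error. -/

namespace DivLcm

open Finset

/-- Here `(z * d) ^ 2` bounds the relevant `t (t + 1)`, so `Y = n / (z * d) ^ 2` is a lower bound
for the expected interval length. Taking `z ^ w` just below `Y ^ (1 - δ)` makes the unit errors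
affordable for all `d` values of `t`, while `(z ^ τ) ^ w` remains about `(D / d) ^ τ`. -/
theorem exists_sieve_level {n d z : ℕ} {δ τ : ℝ} (hn : 1 ≤ n) (hδ0 : 0 < δ) (hδ1 : δ ≤ 1 / 4)
    (hz : 2 ≤ z) (hzn : (z : ℝ) ≤ (n : ℝ) ^ (δ / 2)) (hd : 1 ≤ d)
    (hdn : (d : ℝ) ≤ (n : ℝ) ^ (1 / 2 - δ)) (h0 : 0 ≤ τ) :
    ∃ w : ℕ, (d : ℝ) * (z : ℝ) ^ w ≤ (n : ℝ) ^ (1 - δ ^ 2) * (d : ℝ)⁻¹ ∧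
      ((((z : ℝ) ^ τ) ^ w)⁻¹ ≤
        ((z : ℝ) ^ τ) ^ 3 * ((d : ℝ) ^ τ * ((n : ℝ) ^ (1 / 2 - δ)) ^ (-τ))) := by
  have hn1 : (1 : ℝ) ≤ n := by exact_mod_cast hn
  have hz2 : (2 : ℝ) ≤ z := by exact_mod_cast hz
  have hd1 : (1 : ℝ) ≤ d := by exact_mod_cast hd
  generalize (n : ℝ) = N at *
  generalize (z : ℝ) = x at *
  generalize (d : ℝ) = e at *
  have hN0 : 0 < N := by linarith
  have hx0 : 0 < x := by linarith
  have he0 : 0 < e := by linarith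
  set D := N ^ (1 / 2 - δ) with hDdef
  have hD0 : 0 < D := by positivity
  set Y := N / (x * e) ^ 2 with hYdef
  have hY0 : 0 < Y := by positivity
  have hYN : N ^ δ ≤ Y := by
    rw [hYdef, le_div_iff₀ (by positivity)]
    have h1 : x * e ≤ N ^ ((1 - δ) / 2) := by
      calc x * e ≤ N ^ (δ / 2) * N ^ (1 / 2 - δ) := by gcongr
        _ = _ := by rw [← Real.rpow_add hN0]; ring_nf
    calc N ^ δ * (x * e) ^ 2 ≤ N ^ δ * (N ^ ((1 - δ) / 2)) ^ 2 := by gcongr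
      _ = N := by
          rw [← Real.rpow_natCast, ← Real.rpow_mul hN0.le, ← Real.rpow_add hN0]
          norm_num
  have hY1 : 1 ≤ Y := (Real.one_le_rpow hn1 hδ0.le).trans hYN
  obtain ⟨w, hw1, hw2⟩ := exists_nat_pow_near
    (Real.one_le_rpow hY1 (by linarith : 0 ≤ 1 - δ)) (by linarith : 1 < x)
  refine ⟨w, ?_, ?_⟩
  · calc e * x ^ w ≤ e * Y ^ (1 - δ) := by gcongr
      _ = e * (Y * Y ^ (-δ)) := by
          rw [sub_eq_add_neg, Real.rpow_add hY0, Real.rpow_one]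
      _ ≤ e * (Y * (N ^ δ) ^ (-δ)) := by
          have := Real.rpow_le_rpow_of_nonpos (by positivity) hYN (by linarith : -δ ≤ 0)
          gcongr
      _ = (N * N ^ (-δ ^ 2)) * ((x ^ 2)⁻¹ * e⁻¹) := by
          rw [← Real.rpow_mul hN0.le, show δ * -δ = -δ ^ 2 by ring, hYdef]
          field_simp
      _ ≤ (N * N ^ (-δ ^ 2)) * (1 * e⁻¹) := by
          have : (x ^ 2)⁻¹ ≤ 1 := inv_le_one_of_one_le₀ (by nlinarith)
          gcongr
      _ = _ := by
          rw [one_mul, sub_eq_add_neg, Real.rpow_add hN0, Real.rpow_one]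
  · have hc0 : 0 < x ^ τ := by positivity
    have hbase : (Y ^ (1 - δ))⁻¹ ≤ x ^ 2 * e * D⁻¹ := by
      have e1 : Y ^ (1 - δ) * (x ^ 2 * e ^ 2) ≥ N ^ (1 - δ) := by
        have h1 : (x * e) ^ 2 ≥ ((x * e) ^ 2) ^ (1 - δ) := by
          have : 1 ≤ (x * e) ^ 2 := by
            have : 1 ≤ x * e := by nlinarith
            nlinarith
          calc ((x * e) ^ 2) ^ (1 - δ) ≤ ((x * e) ^ 2) ^ (1 : ℝ) :=
                Real.rpow_le_rpow_of_exponent_le this (by linarith)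
            _ = _ := Real.rpow_one _
        calc N ^ (1 - δ) = Y ^ (1 - δ) * ((x * e) ^ 2) ^ (1 - δ) := by
              rw [← Real.mul_rpow hY0.le (by positivity), hYdef, div_mul_cancel₀ _ (by positivity)]
          _ ≤ Y ^ (1 - δ) * (x * e) ^ 2 := by gcongr
          _ = _ := by ring
      have e2 : D * D ≤ N ^ (1 - δ) := by
        rw [hDdef, ← Real.rpow_add hN0]
        exact Real.rpow_le_rpow_of_exponent_le hn1 (by linarith)
      have hYp : 0 < Y ^ (1 - δ) := by positivity
      rw [← div_eq_mul_inv, inv_le_comm₀ hYp (by positivity), inv_div,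
        div_le_iff₀ (by positivity)]
      have e3 : D * e ≤ D * D := by gcongr
      have e4 : D * e ≤ Y ^ (1 - δ) * (x ^ 2 * e) * e := by nlinarith
      exact le_of_mul_le_mul_right e4 he0
    have hpow : (Y ^ (1 - δ)) ^ τ ≤ (x ^ τ) ^ (w + 1) := by
      calc (Y ^ (1 - δ)) ^ τ ≤ (x ^ (w + 1)) ^ τ := Real.rpow_le_rpow (by positivity) hw2.le h0
        _ = _ := by
          rw [← Real.rpow_natCast, ← Real.rpow_natCast, ← Real.rpow_mul hx0.le,
            ← Real.rpow_mul hx0.le, mul_comm]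
    -- Of the three lost factors `x ^ τ`, one comes from passing from `w + 1` to `w` and two from
    -- the `x ^ 2` in `hbase`.
    calc ((x ^ τ) ^ w)⁻¹ = x ^ τ * ((x ^ τ) ^ (w + 1))⁻¹ := by
          rw [pow_succ]
          field_simp
      _ ≤ x ^ τ * ((Y ^ (1 - δ)) ^ τ)⁻¹ := by gcongr
      _ = x ^ τ * ((Y ^ (1 - δ))⁻¹) ^ τ := by rw [Real.inv_rpow (by positivity)]
      _ ≤ x ^ τ * (x ^ 2 * e * D⁻¹) ^ τ := by gcongr
      _ = _ := by
          rw [Real.mul_rpow (by positivity) (by positivity),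
            Real.mul_rpow (by positivity) (by positivity), Real.inv_rpow hD0.le,
            Real.rpow_neg hD0.le, ← Real.rpow_natCast x 2, ← Real.rpow_mul hx0.le,
            mul_comm ((2 : ℕ) : ℝ) τ, Real.rpow_mul hx0.le, Real.rpow_natCast]
          ring

/-- With `c = z ^ τ` in Brun's sieve, the truncation error acquires the factor `D ^ (-τ) * d ^ (-(1
- τ))`, the same as in Rankin's bound for the terms with `d > D`. -/
theorem sum_sieve_error_le {n i d : ℕ} {δ τ : ℝ} (hn : 1 ≤ n) (hδ0 : 0 < δ) (hδ1 : δ ≤ 1 / 4)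
    (hi : 1 ≤ i) (hzn : ((i + 1 : ℕ) : ℝ) ≤ (n : ℝ) ^ (δ / 2)) (hd : 1 ≤ d)
    (hdn : (d : ℝ) ≤ (n : ℝ) ^ (1 / 2 - δ)) (h0 : 0 ≤ τ) {U : ℝ}
    (hU : Real.exp (4 * (((i + 1 : ℕ) : ℝ) ^ τ * primeRecip (i + 1))) ≤ U) :
    ∑ t ∈ Ico (i * d) ((i + 1) * d), |(#(roughIoc (i + 1) (n / (t + 1)) (n / t)) : ℝ) -
        n / (t * (t + 1)) * roughDensity (i + 1)| ≤
      (n : ℝ) ^ (1 - δ ^ 2) * U * (d : ℝ)⁻¹ +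
        2 * n * U * ((i : ℝ) ^ 2)⁻¹ * (((i + 1 : ℕ) : ℝ) ^ τ) ^ 3 *
          ((n : ℝ) ^ (1 / 2 - δ)) ^ (-τ) * (d : ℝ) ^ (-(1 - τ)) := by
  obtain ⟨w, hw1, hw2⟩ := exists_sieve_level hn hδ0 hδ1 (by omega : 2 ≤ i + 1) hzn hd hdn h0
  have hd0 : (0 : ℝ) < d := by exact_mod_cast hd
  have hz1 : (1 : ℝ) ≤ ((i + 1 : ℕ) : ℝ) := by exact_mod_cast (by omega)
  have hc1 : 1 ≤ ((i + 1 : ℕ) : ℝ) ^ τ := Real.one_le_rpow hz1 h0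
  have hH := primeRecip_nonneg (i + 1)
  have hU1 : Real.exp (primeRecip (i + 1)) ≤ U :=
    (Real.exp_le_exp.mpr (by nlinarith)).trans hU
  have hU2 : Real.exp (((i + 1 : ℕ) : ℝ) ^ τ * primeRecip (i + 1)) ≤ U :=
    (Real.exp_le_exp.mpr (by nlinarith [mul_nonneg (zero_le_one.trans hc1) hH])).trans hU
  have hU0 : 0 ≤ U := (Real.exp_pos _).le.trans hU
  set c := ((i + 1 : ℕ) : ℝ) ^ τ with hc
  have hterm : ∀ t ∈ Ico (i * d) ((i + 1) * d),
      |(#(roughIoc (i + 1) (n / (t + 1)) (n / t)) : ℝ) -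
        n / (t * (t + 1)) * roughDensity (i + 1)| ≤
      ((i + 1 : ℕ) : ℝ) ^ w * U + (2 * n * ((c ^ w)⁻¹ * U)) * (1 / ((t : ℝ) * ((t : ℝ) + 1))) := by
    intro t ht
    have ht0 : 0 < t := lt_of_lt_of_le (Nat.mul_pos hi hd) (mem_Ico.mp ht).1
    refine (brun (Nat.succ_pos i) ht0 w hc1).trans ?_
    refine add_le_add (mul_le_mul_of_nonneg_left hU1 (by positivity)) ?_
    have h3 : (c ^ w)⁻¹ * Real.exp (c * primeRecip (i + 1)) ≤ (c ^ w)⁻¹ * U :=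
      mul_le_mul_of_nonneg_left hU2 (by positivity)
    calc _ ≤ 2 * ((n : ℝ) / (t * (t + 1))) * ((c ^ w)⁻¹ * U) :=
          mul_le_mul_of_nonneg_left h3 (by positivity)
      _ = _ := by ring
  refine (sum_le_sum hterm).trans ?_
  rw [sum_add_distrib, sum_const, Nat.card_Ico, nsmul_eq_mul, ← mul_sum,
    show (i + 1) * d - i * d = d by rw [add_mul, one_mul, Nat.add_sub_cancel_left]]
  refine add_le_add ?_ ?_
  · calc (d : ℝ) * (((i + 1 : ℕ) : ℝ) ^ w * U) = (d : ℝ) * ((i + 1 : ℕ) : ℝ) ^ w * U := by ring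
      _ ≤ (n : ℝ) ^ (1 - δ ^ 2) * (d : ℝ)⁻¹ * U := mul_le_mul_of_nonneg_right hw1 hU0
      _ = _ := by ring
  · calc _ ≤ (2 * n * ((c ^ 3 * ((d : ℝ) ^ τ * ((n : ℝ) ^ (1 / 2 - δ)) ^ (-τ))) * U)) *
          (((i : ℝ) ^ 2)⁻¹ * (d : ℝ)⁻¹) := by
          refine mul_le_mul ?_ (sum_Ico_le hi hd) (sum_nonneg fun _ _ => by positivity)
            (by positivity)
          gcongr
      _ = _ := by
          rw [show -(1 - τ) = τ + -1 by ring, Real.rpow_add hd0, Real.rpow_neg_one]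
          ring

/-- The contribution of a fixed quotient `i = n / a`. -/
theorem abs_sum_main_sub_le {f : ℕ → ℕ → ℝ} {A : ℝ}
    (hb : ∀ a n : ℕ, 1 ≤ a → a ≤ n → |f a n| ≤ A * (1 + Real.log ((n : ℝ) / (a : ℝ))))
    {n i : ℕ} {δ τ lam : ℝ} (hn : 1 ≤ n) (hδ0 : 0 < δ) (hδ1 : δ ≤ 1 / 4)
    (hi : 1 ≤ i) (hzn : ((i + 1 : ℕ) : ℝ) ≤ (n : ℝ) ^ (δ / 2)) (h0 : 0 ≤ τ) (h1 : τ ≤ 1 / 4)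
    (hlam : ((i + 1 : ℕ) : ℝ) ^ τ ≤ lam) {U : ℝ}
    (hU : Real.exp (4 * (((i + 1 : ℕ) : ℝ) ^ τ * primeRecip (i + 1))) ≤ U) :
    |∑ d ∈ smoothUpTo (i + 1) n ((n : ℝ) ^ (1 / 2 - δ)),
        (∑ t ∈ Ico (i * d) ((i + 1) * d),
          f d t * #(roughIoc (i + 1) (n / (t + 1)) (n / t)) - n * seriesTerm f i d)| ≤
      A * (1 + Real.log n) * ((n : ℝ) ^ (1 - δ ^ 2) * U ^ 2 +
        2 * n * U ^ 2 * lam ^ 3 * (((i : ℝ) ^ 2)⁻¹ * ((n : ℝ) ^ (1 / 2 - δ)) ^ (-τ))) := by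
  have hn1 : (1 : ℝ) ≤ n := by exact_mod_cast hn
  have hlogn := Real.log_nonneg hn1
  have hA := nonneg_of_bound hb
  have hU0 : 0 ≤ U := (Real.exp_pos _).le.trans hU
  have hz1 : (1 : ℝ) ≤ ((i + 1 : ℕ) : ℝ) := by exact_mod_cast (by omega)
  have hc1 : 1 ≤ ((i + 1 : ℕ) : ℝ) ^ τ := Real.one_le_rpow hz1 h0
  have hlog : Real.log ((i : ℝ) + 1) ≤ Real.log n := by
    refine Real.log_le_log (by positivity) ?_
    calc (i : ℝ) + 1 = ((i + 1 : ℕ) : ℝ) := by push_cast; ring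
      _ ≤ (n : ℝ) ^ (δ / 2) := hzn
      _ ≤ (n : ℝ) ^ (1 : ℝ) := Real.rpow_le_rpow_of_exponent_le hn1 (by linarith)
      _ = n := Real.rpow_one _
  set D := (n : ℝ) ^ (1 / 2 - δ) with hD
  have hF : ∀ d ∈ smoothUpTo (i + 1) n D, d ∈ Nat.smoothNumbers (i + 1) :=
    fun d hd => (mem_smoothUpTo.mp hd).2.1
  have hterm : ∀ d ∈ smoothUpTo (i + 1) n D,
      |∑ t ∈ Ico (i * d) ((i + 1) * d),
        f d t * #(roughIoc (i + 1) (n / (t + 1)) (n / t)) - n * seriesTerm f i d| ≤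
      A * (1 + Real.log n) * ((n : ℝ) ^ (1 - δ ^ 2) * U * (d : ℝ)⁻¹ +
        2 * n * U * ((i : ℝ) ^ 2)⁻¹ * (((i + 1 : ℕ) : ℝ) ^ τ) ^ 3 * D ^ (-τ) *
          (d : ℝ) ^ (-(1 - τ))) := by
    intro d hd
    obtain ⟨⟨hd1, _⟩, _, hdD⟩ := mem_smoothUpTo.mp hd
    have e : ∑ t ∈ Ico (i * d) ((i + 1) * d),
        f d t * #(roughIoc (i + 1) (n / (t + 1)) (n / t)) - n * seriesTerm f i d =
        ∑ t ∈ Ico (i * d) ((i + 1) * d), f d t *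
          ((#(roughIoc (i + 1) (n / (t + 1)) (n / t)) : ℝ) -
            n / (t * (t + 1)) * roughDensity (i + 1)) := by
      rw [seriesTerm_eq, mul_sum, ← sum_sub_distrib]
      exact sum_congr rfl fun t _ => by ring
    rw [e]
    calc _ ≤ ∑ t ∈ Ico (i * d) ((i + 1) * d), A * (1 + Real.log n) *
          |(#(roughIoc (i + 1) (n / (t + 1)) (n / t)) : ℝ) -
            n / (t * (t + 1)) * roughDensity (i + 1)| := by
          refine (abs_sum_le_sum_abs _ _).trans (sum_le_sum fun t ht => ?_)
          rw [abs_mul]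
          refine mul_le_mul_of_nonneg_right ((abs_le_of_mem_Ico hb hi hd1 ht).trans ?_)
            (abs_nonneg _)
          exact mul_le_mul_of_nonneg_left (by linarith) hA
      _ ≤ _ := by
          rw [← mul_sum]
          exact mul_le_mul_of_nonneg_left (sum_sieve_error_le hn hδ0 hδ1 hi hzn hd1 hdD h0 hU)
            (by positivity)
  refine (abs_sum_le_sum_abs _ _).trans ((sum_le_sum hterm).trans ?_)
  rw [← mul_sum, sum_add_distrib, ← mul_sum, ← mul_sum]
  refine mul_le_mul_of_nonneg_left ?_ (by positivity)
  -- The case `τ = 0` of the Rankin bound; its exponent is below the one in `hU` because `z ^ τ ≥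
  -- 1`.
  have hS1 : ∑ d ∈ smoothUpTo (i + 1) n D, (d : ℝ)⁻¹ ≤ U := by
    have h := sum_smooth_rpow_le (τ := 0) le_rfl (by norm_num) hF
    simp only [sub_zero, Real.rpow_neg_one, Real.rpow_zero, one_mul] at h
    refine (h.trans (Real.exp_le_exp.mpr ?_)).trans hU
    nlinarith [primeRecip_nonneg (i + 1)]
  have hS2 := (sum_smooth_rpow_le h0 h1 hF).trans hU
  refine add_le_add ?_ ?_
  · calc _ ≤ (n : ℝ) ^ (1 - δ ^ 2) * U * U := mul_le_mul_of_nonneg_left hS1 (by positivity)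
      _ = _ := by ring
  · calc _ ≤ 2 * n * U * ((i : ℝ) ^ 2)⁻¹ * (((i + 1 : ℕ) : ℝ) ^ τ) ^ 3 * D ^ (-τ) * U :=
          mul_le_mul_of_nonneg_left hS2 (by positivity)
      _ ≤ 2 * n * U * ((i : ℝ) ^ 2)⁻¹ * lam ^ 3 * D ^ (-τ) * U := by gcongr
      _ = _ := by ring

end DivLcm

/-! ### Assembly of the error terms with free parameters. -/

namespace DivLcm

open Finset

/-- One factor `1 / i` is spent on `v i` to reach `Q`; the other sums to a logarithm. -/
theorem sum_inv_sq_mul_le {y : ℕ} {v : ℕ → ℝ} {Q W : ℝ} (hW : 1 + Real.log y ≤ W)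
    (hv : ∀ i, 1 ≤ i → i ≤ y → 0 ≤ v i ∧ ((i + 1 : ℕ) : ℝ)⁻¹ * v i ≤ Q) (hQ : 0 ≤ Q) :
    ∑ i ∈ Icc 1 y, ((i : ℝ) ^ 2)⁻¹ * v i ≤ 2 * Q * W := by
  have hh : ∑ i ∈ Icc 1 y, (i : ℝ)⁻¹ ≤ W := by
    have h := harmonic_le_one_add_log y
    rw [harmonic_eq_sum_Icc] at h
    push_cast at h
    exact h.trans hW
  calc _ ≤ ∑ i ∈ Icc 1 y, 2 * Q * (i : ℝ)⁻¹ := by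
        refine sum_le_sum fun i hi => ?_
        obtain ⟨hi1, hiy⟩ := mem_Icc.mp hi
        obtain ⟨h0, h⟩ := hv i hi1 hiy
        have hi' : (1 : ℝ) ≤ i := by exact_mod_cast hi1
        have h2 : (i : ℝ)⁻¹ ≤ 2 * ((i + 1 : ℕ) : ℝ)⁻¹ := by
          push_cast
          rw [← div_eq_mul_inv, inv_le_comm₀ (by positivity) (by positivity), inv_div]
          linarith
        calc ((i : ℝ) ^ 2)⁻¹ * v i = (i : ℝ)⁻¹ * ((i : ℝ)⁻¹ * v i) := by
              rw [sq, mul_inv, mul_assoc]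
          _ ≤ (i : ℝ)⁻¹ * ((2 * ((i + 1 : ℕ) : ℝ)⁻¹) * v i) := by gcongr
          _ = (i : ℝ)⁻¹ * (2 * (((i + 1 : ℕ) : ℝ)⁻¹ * v i)) := by ring
          _ ≤ (i : ℝ)⁻¹ * (2 * Q) := by gcongr
          _ = _ := by ring
    _ = 2 * Q * ∑ i ∈ Icc 1 y, (i : ℝ)⁻¹ := by rw [mul_sum]
    _ ≤ _ := mul_le_mul_of_nonneg_left hh (by positivity)

/-- The error in terms of unspecified parameters. -/
theorem abs_sum_sub_const_le {f : ℕ → ℕ → ℝ} {A : ℝ}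
    (hf : DependsOnlyOnComponent divisorGraph f ∨ DependsOnlyOnComponent lcmGraph f)
    (hb : ∀ a n : ℕ, 1 ≤ a → a ≤ n → |f a n| ≤ A * (1 + Real.log ((n : ℝ) / (a : ℝ))))
    {n y : ℕ} {δ lam Q U : ℝ} {τ : ℕ → ℝ} (hn : 1 ≤ n) (hy : 1 ≤ y) (hδ0 : 0 < δ)
    (hδ1 : δ ≤ 1 / 4) (hyn : ((y + 1 : ℕ) : ℝ) ≤ (n : ℝ) ^ (δ / 2)) (hU0 : 0 ≤ U) (hQ0 : 0 ≤ Q)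
    (hlam : ∀ z, 2 ≤ z → z ≤ 2 * y → (z : ℝ) ^ τ z ≤ lam)
    (hτ : ∀ z, 2 ≤ z → z ≤ 2 * y → (0 ≤ τ z ∧ τ z ≤ 1 / 4) ∧
      Real.exp (4 * ((z : ℝ) ^ τ z * primeRecip z)) ≤ U ∧
      (z : ℝ)⁻¹ * ((n : ℝ) ^ (1 / 2 - δ)) ^ (-τ z) ≤ Q) :
    |∑ a ∈ Icc 1 n, f a n - (n : ℝ) * seriesConst f| ≤
      A * (1 + Real.log n) * (n / ((y + 1 : ℕ) : ℝ) + (1 + 2 * Real.log n) * (2 * n * (Q * U))) +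
      A * (1 + Real.log n) * (y * ((n : ℝ) ^ (1 - δ ^ 2) * U ^ 2) +
        2 * n * U ^ 2 * lam ^ 3 * (2 * Q * (1 + Real.log n))) +
      n * (A * (1 + Real.log n) * U * (2 * Q * (1 + Real.log n)) +
        A * (1 + 2 / δ) * ((y + 1 : ℕ) : ℝ) ^ (-(1 - 2 * δ)) * zetaAt δ) := by
  have hn1 : (1 : ℝ) ≤ n := by exact_mod_cast hn
  have hn0 : (0 : ℝ) < n := by linarith
  have hlogn := Real.log_nonneg hn1
  have hA := nonneg_of_bound hb
  have hyn' : y + 1 ≤ n := by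
    have : ((y + 1 : ℕ) : ℝ) ≤ n := by
      calc _ ≤ _ := hyn
        _ ≤ (n : ℝ) ^ (1 : ℝ) := Real.rpow_le_rpow_of_exponent_le hn1 (by linarith)
        _ = n := Real.rpow_one _
    exact_mod_cast this
  have hylog : Real.log y ≤ Real.log n :=
    Real.log_le_log (by exact_mod_cast hy) (by exact_mod_cast (by omega : y ≤ n))
  set D := (n : ℝ) ^ (1 / 2 - δ) with hD
  have hD0 : 0 < D := by positivity
  have hDn : D ≤ n := by
    calc D ≤ (n : ℝ) ^ (1 : ℝ) := Real.rpow_le_rpow_of_exponent_le hn1 (by linarith)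
      _ = n := Real.rpow_one _
  set g : ℕ → ℝ := fun i => ∑' d : Nat.smoothNumbers (i + 1), seriesTerm f i d with hg
  have hsumQ : ∑ i ∈ Icc 1 y, ((i : ℝ) ^ 2)⁻¹ * D ^ (-τ (i + 1)) ≤ 2 * Q * (1 + Real.log n) :=
    sum_inv_sq_mul_le (by linarith) (fun i hi hiy =>
      ⟨by positivity, (hτ (i + 1) (by omega) (by omega)).2.2⟩) hQ0
  -- Four errors: `hT1` discards the exceptional `a`, `hT2` replaces sieve counts by densities,
  -- `hT3` restores the `d > D` of the series, and `hT4` its `i > y`.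
  have hT1 := abs_sum_sub_sum_mainRange_le hb hy (by omega : y ≤ n) hD0 hτ
  have hT2 : |∑ a ∈ mainRange n y D, f a n -
      ∑ i ∈ Icc 1 y, n * ∑ d ∈ smoothUpTo (i + 1) n D, seriesTerm f i d| ≤
      A * (1 + Real.log n) * (y * ((n : ℝ) ^ (1 - δ ^ 2) * U ^ 2) +
        2 * n * U ^ 2 * lam ^ 3 * (2 * Q * (1 + Real.log n))) := by
    rw [sum_mainRange hf, ← sum_sub_distrib]
    simp only [mul_sum, ← sum_sub_distrib]
    calc _ ≤ ∑ i ∈ Icc 1 y, A * (1 + Real.log n) * ((n : ℝ) ^ (1 - δ ^ 2) * U ^ 2 +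
          2 * n * U ^ 2 * lam ^ 3 * (((i : ℝ) ^ 2)⁻¹ * D ^ (-τ (i + 1)))) := by
          refine (abs_sum_le_sum_abs _ _).trans (sum_le_sum fun i hi => ?_)
          obtain ⟨hi1, hiy⟩ := mem_Icc.mp hi
          obtain ⟨⟨h0, h1⟩, hU, _⟩ := hτ (i + 1) (by omega) (by omega)
          refine abs_sum_main_sub_le hb hn hδ0 hδ1 hi1 (le_trans ?_ hyn) h0 h1
            (hlam (i + 1) (by omega) (by omega)) hU
          exact_mod_cast (by omega : i + 1 ≤ y + 1)
      _ = A * (1 + Real.log n) * (y * ((n : ℝ) ^ (1 - δ ^ 2) * U ^ 2) +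
          2 * n * U ^ 2 * lam ^ 3 * ∑ i ∈ Icc 1 y, ((i : ℝ) ^ 2)⁻¹ * D ^ (-τ (i + 1))) := by
          rw [← mul_sum, sum_add_distrib, sum_const, Nat.card_Icc, nsmul_eq_mul, ← mul_sum,
            Nat.add_sub_cancel]
      _ ≤ _ := by
          have h3 : 0 ≤ lam := by
            have := hlam 2 le_rfl (by omega)
            exact le_trans (by positivity) this
          gcongr
  have hT3 : |∑ i ∈ Icc 1 y, g i - ∑ i ∈ Icc 1 y, ∑ d ∈ smoothUpTo (i + 1) n D, seriesTerm f i d| ≤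
      A * (1 + Real.log n) * U * (2 * Q * (1 + Real.log n)) := by
    rw [← sum_sub_distrib]
    calc _ ≤ ∑ i ∈ Icc 1 y, A * (1 + Real.log n) * U * (((i : ℝ) ^ 2)⁻¹ * D ^ (-τ (i + 1))) := by
          refine (abs_sum_le_sum_abs _ _).trans (sum_le_sum fun i hi => ?_)
          obtain ⟨hi1, hiy⟩ := mem_Icc.mp hi
          obtain ⟨⟨h0, h1⟩, hU, _⟩ := hτ (i + 1) (by omega) (by omega)
          refine (abs_tsum_sub_sum_smoothUpTo_le hb hi1 hD0 hDn h0 h1).trans ?_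
          have hl : Real.log ((i : ℝ) + 1) ≤ Real.log n :=
            Real.log_le_log (by positivity) (by exact_mod_cast (by omega : i + 1 ≤ n))
          calc _ ≤ A * (1 + Real.log n) * ((i : ℝ) ^ 2)⁻¹ * (D ^ (-τ (i + 1)) * U) := by gcongr
            _ = _ := by ring
      _ ≤ _ := by
          rw [← mul_sum]
          gcongr
  have hT4 := abs_tsum_sub_sum_Icc_le hδ0 hδ1 (g := g) hA
    (fun i hi => abs_tsum_seriesTerm_le hb hi) y
  have hC : seriesConst f = ∑' i : ℕ+, g i := rfl
  have e : ∑ a ∈ Icc 1 n, f a n - (n : ℝ) * seriesConst f =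
      (∑ a ∈ Icc 1 n, f a n - ∑ a ∈ mainRange n y D, f a n) +
      (∑ a ∈ mainRange n y D, f a n -
        ∑ i ∈ Icc 1 y, n * ∑ d ∈ smoothUpTo (i + 1) n D, seriesTerm f i d) +
      -(n * ((∑ i ∈ Icc 1 y, g i -
          ∑ i ∈ Icc 1 y, ∑ d ∈ smoothUpTo (i + 1) n D, seriesTerm f i d) +
        (∑' i : ℕ+, g i - ∑ i ∈ Icc 1 y, g i))) := by
    rw [hC, ← mul_sum]
    ring
  rw [e]
  refine (abs_add_le _ _).trans (add_le_add ((abs_add_le _ _).trans (add_le_add hT1 hT2)) ?_)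
  rw [abs_neg, abs_mul, abs_of_pos hn0]
  exact mul_le_mul_of_nonneg_left ((abs_add_le _ _).trans (add_le_add hT3 hT4)) hn0.le

end DivLcm

/-! ### Choice of the parameters and optimization. -/

namespace DivLcm

open Finset Filter

/-- `√(x log x)`. -/
noncomputable def rate (x : ℝ) : ℝ := Real.sqrt (x * Real.log x)

theorem rate_nonneg (x : ℝ) : 0 ≤ rate x := Real.sqrt_nonneg _

theorem eventually_log_le {c r : ℝ} (hc : 0 < c) (hr : 0 < r) :
    ∀ᶠ x : ℝ in atTop, Real.log x ≤ c * x ^ r := by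
  filter_upwards [(isLittleO_log_rpow_atTop hr).bound hc, eventually_ge_atTop 0] with x hx h0
  rw [Real.norm_of_nonneg (by positivity : 0 ≤ x ^ r)] at hx
  exact (le_abs_self _).trans hx

theorem eventually_rate_le {c : ℝ} (hc : 0 < c) : ∀ᶠ x : ℝ in atTop, rate x ≤ c * x := by
  filter_upwards [eventually_log_le (sq_pos_of_pos hc) one_pos, eventually_ge_atTop 0] with x hx h0
  rw [Real.rpow_one] at hx
  rw [rate, Real.sqrt_le_iff]
  exact ⟨by positivity, by nlinarith⟩

theorem sqrt_le_rate {x : ℝ} (hx : 0 ≤ x) (h : 1 ≤ Real.log x) : x ^ (1 / 2 : ℝ) ≤ rate x := by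
  rw [← Real.sqrt_eq_rpow]
  exact Real.sqrt_le_sqrt (by nlinarith)

/-- What has to hold for `x = log n`. -/
structure LargeLog (δ x : ℝ) : Prop where
  -- Purposes of the later fields, in order: `y + 1 ≤ n ^ (δ / 2)`; the unit sieve errors over all
  -- `i ≤ y`; the cap `1 / 4` on the Rankin exponent (and `log z` against `x`); Euler products at
  -- most `exp (δ R)`; powers of `log n` at most `exp (2 δ R)`.
  one_le_log : 1 ≤ Real.log x
  rate_add_one_le : rate x + 1 ≤ δ / 2 * x
  two_rate_le : 2 * rate x ≤ δ ^ 2 * x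
  rate_le : rate x ≤ x / 16
  rpow_mul_log_le : 32 * (x ^ (1 / 2 - δ) * Real.log x) ≤ δ * rate x
  log_le : 5 * Real.log (1 + x) ≤ 2 * δ * rate x

theorem eventually_largeLog {δ : ℝ} (h0 : 0 < δ) : ∀ᶠ x : ℝ in atTop, LargeLog δ x := by
  filter_upwards [Real.tendsto_log_atTop.eventually_ge_atTop 1,
    eventually_rate_le (show 0 < δ / 4 by positivity),
    eventually_rate_le (show 0 < δ ^ 2 / 2 by positivity),
    eventually_rate_le (show (0 : ℝ) < 1 / 16 by norm_num),
    eventually_log_le (show 0 < δ / 32 by positivity) h0,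
    eventually_log_le (show 0 < δ / 5 by positivity) (show (0 : ℝ) < 1 / 2 by norm_num),
    eventually_ge_atTop 2, eventually_ge_atTop (4 / δ)] with x h1 h2 h3 h4 h5 h6 h7 h8
  have hx : 0 < x := by linarith
  have hs := sqrt_le_rate hx.le h1
  rw [div_le_iff₀ h0] at h8
  refine ⟨h1, by linarith, by linarith, by linarith, ?_, ?_⟩
  · have e : x ^ (1 / 2 - δ) * x ^ δ = x ^ (1 / 2 : ℝ) := by
      rw [← Real.rpow_add hx]; ring_nf
    have hp : 0 < x ^ (1 / 2 - δ) := by positivity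
    calc 32 * (x ^ (1 / 2 - δ) * Real.log x) ≤ 32 * (x ^ (1 / 2 - δ) * (δ / 32 * x ^ δ)) := by
          gcongr
      _ = δ * (x ^ (1 / 2 - δ) * x ^ δ) := by ring
      _ ≤ δ * rate x := by rw [e]; gcongr
  · have hl : Real.log (1 + x) ≤ 2 * Real.log x := by
      rw [show 2 * Real.log x = Real.log (x ^ 2) by rw [Real.log_pow]; norm_num]
      exact Real.log_le_log (by linarith) (by nlinarith)
    have : δ * x ^ (1 / 2 : ℝ) ≤ δ * rate x := by gcongr
    linarith

/-- The exponent used in Rankin's trick. -/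
noncomputable def rankinExp (lam : ℝ) (z : ℕ) : ℝ := min (1 / 4) (Real.log lam / Real.log z)

theorem rpow_rankinExp_le {lam : ℝ} (hl : 1 ≤ lam) {z : ℕ} (hz : 2 ≤ z) :
    (z : ℝ) ^ rankinExp lam z ≤ lam := by
  have hz1 : (1 : ℝ) < z := by exact_mod_cast (by omega)
  have hlog : 0 < Real.log z := Real.log_pos hz1
  calc (z : ℝ) ^ rankinExp lam z ≤ (z : ℝ) ^ (Real.log lam / Real.log z) :=
        Real.rpow_le_rpow_of_exponent_le hz1.le (min_le_right _ _)
    _ = lam := by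
        rw [Real.rpow_def_of_pos (by linarith), mul_div_cancel₀ _ hlog.ne',
          Real.exp_log (by linarith)]

variable {δ x : ℝ}

theorem LargeLog.pos (h : LargeLog δ x) : 0 < x := by
  have := h.rate_le
  have := rate_nonneg x
  rcases (show 0 ≤ x by linarith).eq_or_lt with h0 | h0
  · have := h.one_le_log
    rw [← h0, Real.log_zero] at this
    linarith
  · exact h0

theorem LargeLog.two_le (h : LargeLog δ x) : 2 ≤ x := by
  have h1 := h.one_le_log
  have h2 := Real.log_le_sub_one_of_pos h.pos
  linarith

theorem LargeLog.rate_sq (h : LargeLog δ x) : rate x ^ 2 = x * Real.log x :=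
  Real.sq_sqrt (mul_nonneg h.pos.le (zero_le_one.trans h.one_le_log))

/-- Since `log 2 ≥ 1 / 2`, the exponent `k = ⌈2 R⌉` gives `exp R ≤ 2 ^ k`, and `k ≤ x`. The
resulting `4 * (1 + log x)` is at most `8 * log x` because `log x ≥ 1`. -/
theorem LargeLog.primeRecip_le (h : LargeLog δ x) {y z : ℕ} (hy : (y : ℝ) ≤ Real.exp (rate x))
    (hz : z ≤ 2 * y) : primeRecip z ≤ 8 * Real.log x := by
  set k := ⌈2 * rate x⌉₊ with hk
  have hR0 := rate_nonneg x
  have hx2 := h.two_le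
  have hlog := h.one_le_log
  have hRx := h.rate_le
  have hyk : y ≤ 2 ^ k := by
    have h2 : Real.exp (rate x) ≤ (2 : ℝ) ^ k := by
      rw [← Real.rpow_natCast, Real.rpow_def_of_pos (by norm_num)]
      refine Real.exp_le_exp.mpr ?_
      have h3 : (1 : ℝ) / 2 ≤ Real.log 2 := by linarith [Real.log_two_gt_d9]
      have h4 : 2 * rate x ≤ k := Nat.le_ceil _
      nlinarith
    exact_mod_cast hy.trans h2
  have hzk : z ≤ 2 ^ (k + 1) := by rw [pow_succ]; omega
  refine (DivLcm.primeRecip_le hzk).trans ?_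
  have hlk : Real.log k ≤ Real.log x := by
    rcases Nat.eq_zero_or_pos k with h0 | h0
    · rw [h0, Nat.cast_zero, Real.log_zero]; linarith
    · refine Real.log_le_log (by exact_mod_cast h0) ?_
      have := Nat.ceil_lt_add_one (show 0 ≤ 2 * rate x by positivity)
      linarith
  linarith

theorem LargeLog.one_le_rpow (h : LargeLog δ x) (hδ1 : δ ≤ 1 / 4) : 1 ≤ x ^ (1 / 2 - δ) :=
  Real.one_le_rpow (by linarith [h.two_le]) (by linarith)

theorem LargeLog.rankinExp_nonneg (h : LargeLog δ x) (hδ1 : δ ≤ 1 / 4) {z : ℕ} :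
    0 ≤ rankinExp (x ^ (1 / 2 - δ)) z := by
  refine le_min (by norm_num) (div_nonneg (Real.log_nonneg (h.one_le_rpow hδ1)) ?_)
  exact Real.log_natCast_nonneg z

theorem LargeLog.exp_rankin_le (h : LargeLog δ x) (hδ1 : δ ≤ 1 / 4) {y z : ℕ}
    (hy : (y : ℝ) ≤ Real.exp (rate x)) (hz2 : 2 ≤ z) (hz : z ≤ 2 * y) :
    Real.exp (4 * ((z : ℝ) ^ rankinExp (x ^ (1 / 2 - δ)) z * primeRecip z)) ≤
      Real.exp (δ * rate x) := by
  refine Real.exp_le_exp.mpr ?_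
  have h1 := rpow_rankinExp_le (h.one_le_rpow hδ1) hz2
  have h2 := h.primeRecip_le hy hz
  have h3 := h.rpow_mul_log_le
  have hl := h.one_le_rpow hδ1
  calc 4 * ((z : ℝ) ^ rankinExp (x ^ (1 / 2 - δ)) z * primeRecip z) ≤
      4 * (x ^ (1 / 2 - δ) * (8 * Real.log x)) := by
        have := primeRecip_nonneg z
        gcongr
    _ = 32 * (x ^ (1 / 2 - δ) * Real.log x) := by ring
    _ ≤ _ := h3

/-- The optimization over the quotient `z`. -/
theorem LargeLog.inv_mul_rpow_le (h : LargeLog δ x) (hδ0 : 0 < δ) (hδ1 : δ ≤ 1 / 4) {z : ℕ}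
    (hz2 : 2 ≤ z) :
    (z : ℝ)⁻¹ * (Real.exp x ^ (1 / 2 - δ)) ^ (-rankinExp (x ^ (1 / 2 - δ)) z) ≤
      Real.exp (-(1 - 2 * δ) * rate x) := by
  have hz1 : (1 : ℝ) < z := by exact_mod_cast (by omega)
  have hL : 0 < Real.log z := Real.log_pos hz1
  have hx := h.pos
  have hlogx := h.one_le_log
  have hR := rate_nonneg x
  have e : (z : ℝ)⁻¹ * (Real.exp x ^ (1 / 2 - δ)) ^ (-rankinExp (x ^ (1 / 2 - δ)) z) =
      Real.exp (-(Real.log z + (1 / 2 - δ) * x * rankinExp (x ^ (1 / 2 - δ)) z)) := by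
    rw [← Real.exp_mul, ← Real.exp_mul, neg_add, Real.exp_add, Real.exp_neg (Real.log z),
      Real.exp_log (by linarith)]
    congr 2
    ring
  rw [e]
  refine Real.exp_le_exp.mpr ?_
  suffices hs : (1 - 2 * δ) * rate x ≤
      Real.log z + (1 / 2 - δ) * x * rankinExp (x ^ (1 / 2 - δ)) z by linarith
  rw [rankinExp, Real.log_rpow hx]
  rcases min_choice (1 / 4 : ℝ) ((1 / 2 - δ) * Real.log x / Real.log z) with hm | hm
  -- When the exponent is capped at `1 / 4`, the factor `D ^ (-1 / 4)` alone suffices, because `R ≤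
  -- x / 16`.
  · rw [hm]
    have := h.rate_le
    nlinarith
  · rw [hm]
    have hsq := h.rate_sq
    have e2 : Real.log z + (1 / 2 - δ) * x * ((1 / 2 - δ) * Real.log x / Real.log z) =
        (Real.log z ^ 2 + ((1 / 2 - δ) * rate x) ^ 2) / Real.log z := by
      rw [mul_pow, hsq]
      field_simp
    rw [e2, le_div_iff₀ hL]
    -- The inequality of the means for `log z` and `(1 / 2 - δ) R`, with near-equality when `log z`
    -- is about `R / 2`.
    nlinarith [sq_nonneg (Real.log z - (1 / 2 - δ) * rate x)]

theorem LargeLog.pow_mul_pow_le (h : LargeLog δ x) (hδ0 : 0 < δ) (hδ1 : δ ≤ 1 / 4) :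
    (x ^ (1 / 2 - δ)) ^ 3 * (1 + x) ^ 2 ≤ Real.exp (2 * δ * rate x) := by
  have hx := h.pos
  have h1 : x ^ (1 / 2 - δ) ≤ 1 + x := by
    calc x ^ (1 / 2 - δ) ≤ x ^ (1 : ℝ) :=
          Real.rpow_le_rpow_of_exponent_le (by linarith [h.two_le]) (by linarith)
      _ ≤ 1 + x := by rw [Real.rpow_one]; linarith
  calc (x ^ (1 / 2 - δ)) ^ 3 * (1 + x) ^ 2 ≤ (1 + x) ^ 3 * (1 + x) ^ 2 := by gcongr
    _ = Real.exp (5 * Real.log (1 + x)) := by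
        rw [← pow_add, show 5 * Real.log (1 + x) = Real.log ((1 + x) ^ 5) by
          rw [Real.log_pow]; norm_num, Real.exp_log (by positivity)]
    _ ≤ _ := Real.exp_le_exp.mpr h.log_le

theorem zetaAt_nonneg (δ : ℝ) : 0 ≤ zetaAt δ := tsum_nonneg fun _ => by positivity

/-- The bookkeeping of the five error terms. -/
theorem error_terms_le {A n W Q U G L r y v s c : ℝ} (hA : 0 ≤ A) (hn : 0 ≤ n) (hW : 1 ≤ W)
    (hQ : 0 ≤ Q) (hU : 1 ≤ U) (hL : 1 ≤ L) (hG : L * W ^ 2 ≤ G) (hr : r ≤ n * Q)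
    (hv : y * v ≤ n * Q) (hs : s ≤ Q) (hc : 0 ≤ c) :
    A * W * (r + (2 * W - 1) * (2 * n * (Q * U))) +
      A * W * (y * (v * U ^ 2) + 2 * n * U ^ 2 * L * (2 * Q * W)) +
      n * (A * W * U * (2 * Q * W) + A * c * s) ≤ (12 + c) * (A * n * (Q * U ^ 2 * G)) := by
  have hW2G : W ^ 2 ≤ G := by nlinarith [sq_nonneg W]
  have hWG : W ≤ G := by nlinarith
  have hG1 : 1 ≤ G := hW.trans hWG
  have hU2 : 1 ≤ U ^ 2 := one_le_pow₀ hU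
  have hUU : U ≤ U ^ 2 := by nlinarith
  have hAn : 0 ≤ A * n := by positivity
  have b0 : Q ≤ Q * U ^ 2 * G := by
    calc Q = Q * 1 * 1 := by ring
      _ ≤ _ := by gcongr
  have b1 : W * r ≤ n * (Q * U ^ 2 * G) := by
    calc W * r ≤ W * (n * Q) := by gcongr
      _ ≤ G * (n * Q) := by gcongr
      _ = n * (Q * 1 * G) := by ring
      _ ≤ _ := by gcongr
  have b2 : W ^ 2 * (Q * U) ≤ Q * U ^ 2 * G := by
    calc W ^ 2 * (Q * U) ≤ G * (Q * U ^ 2) := by gcongr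
      _ = _ := by ring
  have b3 : W * (y * (v * U ^ 2)) ≤ n * (Q * U ^ 2 * G) := by
    calc W * (y * (v * U ^ 2)) = W * U ^ 2 * (y * v) := by ring
      _ ≤ W * U ^ 2 * (n * Q) := by gcongr
      _ ≤ G * U ^ 2 * (n * Q) := by gcongr
      _ = _ := by ring
  have b4 : U ^ 2 * (L * W ^ 2) * Q ≤ Q * U ^ 2 * G := by
    calc U ^ 2 * (L * W ^ 2) * Q ≤ U ^ 2 * G * Q := by gcongr
      _ = _ := by ring
  generalize Q * U ^ 2 * G = M at *
  have c1 : A * W * (r + (2 * W - 1) * (2 * n * (Q * U))) ≤ A * n * (5 * M) := by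
    calc _ ≤ A * W * (r + (2 * W) * (2 * n * (Q * U))) := by
          gcongr
          linarith
      _ = A * (W * r) + 4 * (A * n) * (W ^ 2 * (Q * U)) := by ring
      _ ≤ A * (n * M) + 4 * (A * n) * M := by gcongr
      _ = _ := by ring
  have c2 : A * W * (y * (v * U ^ 2) + 2 * n * U ^ 2 * L * (2 * Q * W)) ≤ A * n * (5 * M) := by
    calc _ = A * (W * (y * (v * U ^ 2))) + 4 * (A * n) * (U ^ 2 * (L * W ^ 2) * Q) := by ring
      _ ≤ A * (n * M) + 4 * (A * n) * M := by gcongr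
      _ = _ := by ring
  have c3 : n * (A * W * U * (2 * Q * W) + A * c * s) ≤ A * n * ((2 + c) * M) := by
    calc _ = 2 * (A * n) * (W ^ 2 * (Q * U)) + (A * n) * c * s := by ring
      _ ≤ 2 * (A * n) * M + (A * n) * c * M := by
          have := hs.trans b0
          gcongr
      _ = _ := by ring
  linarith

/-- All errors are at most a constant times `A n Q U ^ 2 G`. The factors `Q`, `U ^ 2` and `G` each
lose `2 δ` in the exponent, which gives `1 - 6 δ`. -/
theorem abs_sum_sub_const_le_of_largeLog {f : ℕ → ℕ → ℝ} {A : ℝ}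
    (hf : DependsOnlyOnComponent divisorGraph f ∨ DependsOnlyOnComponent lcmGraph f)
    (hb : ∀ a n : ℕ, 1 ≤ a → a ≤ n → |f a n| ≤ A * (1 + Real.log ((n : ℝ) / (a : ℝ))))
    (hδ0 : 0 < δ) (hδ1 : δ ≤ 1 / 4) {n : ℕ} (hn : 1 ≤ n) (h : LargeLog δ (Real.log n)) :
    |∑ a ∈ Icc 1 n, f a n - (n : ℝ) * seriesConst f| ≤
      (12 + (1 + 2 / δ) * zetaAt δ) * (A * n * Real.exp (-(1 - 6 * δ) * rate (Real.log n))) := by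
  have hn1 : (1 : ℝ) ≤ n := by exact_mod_cast hn
  have hn0 : (0 : ℝ) < n := by linarith
  have hA := nonneg_of_bound hb
  set x := Real.log n with hxdef
  have hexp : Real.exp x = n := Real.exp_log hn0
  have hx := h.pos
  have hR := rate_nonneg x
  set R := rate x with hRdef
  set y := ⌊Real.exp R⌋₊ with hydef
  have hyle : (y : ℝ) ≤ Real.exp R := Nat.floor_le (Real.exp_pos _).le
  have hylt : Real.exp R < ((y + 1 : ℕ) : ℝ) := by
    push_cast; exact Nat.lt_floor_add_one _
  have hy : 1 ≤ y := Nat.le_floor (by simpa using Real.one_le_exp hR)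
  have hy0 : (0 : ℝ) < ((y + 1 : ℕ) : ℝ) := by positivity
  have hyn : ((y + 1 : ℕ) : ℝ) ≤ (n : ℝ) ^ (δ / 2) := by
    rw [← hexp, ← Real.exp_mul]
    calc ((y + 1 : ℕ) : ℝ) ≤ Real.exp R * 2 := by
          push_cast; linarith [Real.one_le_exp hR]
      _ ≤ Real.exp R * Real.exp 1 := by
          have := Real.add_one_le_exp (1 : ℝ)
          gcongr
          linarith
      _ = Real.exp (R + 1) := (Real.exp_add _ _).symm
      _ ≤ _ := Real.exp_le_exp.mpr (by linarith [h.rate_add_one_le])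
  set Q := Real.exp (-(1 - 2 * δ) * R) with hQ
  set U := Real.exp (δ * R) with hU
  set G := Real.exp (2 * δ * R) with hG
  set lam := x ^ (1 / 2 - δ) with hlamdef
  have hlam1 : 1 ≤ lam := h.one_le_rpow hδ1
  have hmain := abs_sum_sub_const_le hf hb (n := n) (y := y) (δ := δ) (lam := lam) (Q := Q) (U := U)
    (τ := rankinExp lam) hn hy hδ0 hδ1 hyn (Real.exp_pos _).le (Real.exp_pos _).le
    (fun z hz2 _ => rpow_rankinExp_le hlam1 hz2)
    (fun z hz2 hzy => ⟨⟨h.rankinExp_nonneg hδ1, min_le_left _ _⟩,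
      h.exp_rankin_le hδ1 hyle hz2 hzy, by
        have := h.inv_mul_rpow_le hδ0 hδ1 hz2
        rwa [hexp] at this⟩)
  have hU1 : 1 ≤ U := Real.one_le_exp (by positivity)
  have hM : Real.exp (-(1 - 6 * δ) * R) = Q * U ^ 2 * G := by
    rw [hQ, hU, hG, ← Real.exp_nat_mul, ← Real.exp_add, ← Real.exp_add]
    congr 1
    push_cast
    ring
  have heQ : Real.exp (-R) ≤ Q := Real.exp_le_exp.mpr (by nlinarith)
  have hr : (n : ℝ) / ((y + 1 : ℕ) : ℝ) ≤ n * Q := by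
    calc (n : ℝ) / ((y + 1 : ℕ) : ℝ) ≤ n / Real.exp R := by gcongr
      _ = n * Real.exp (-R) := by rw [Real.exp_neg, div_eq_mul_inv]
      _ ≤ n * Q := by gcongr
  have hv : (y : ℝ) * (n : ℝ) ^ (1 - δ ^ 2) ≤ n * Q := by
    have e1 : (n : ℝ) ^ (1 - δ ^ 2) = n * Real.exp (-(δ ^ 2 * x)) := by
      rw [sub_eq_add_neg, Real.rpow_add hn0, Real.rpow_one, Real.rpow_def_of_pos hn0]
      congr 2
      ring
    have e2 : (y : ℝ) * Real.exp (-(δ ^ 2 * x)) ≤ Q := by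
      calc (y : ℝ) * Real.exp (-(δ ^ 2 * x)) ≤ Real.exp R * Real.exp (-(δ ^ 2 * x)) := by gcongr
        _ = Real.exp (R + -(δ ^ 2 * x)) := (Real.exp_add _ _).symm
        _ ≤ Real.exp (-R) := Real.exp_le_exp.mpr (by linarith [h.two_rate_le])
        _ ≤ Q := heQ
    calc (y : ℝ) * (n : ℝ) ^ (1 - δ ^ 2) = n * (y * Real.exp (-(δ ^ 2 * x))) := by rw [e1]; ring
      _ ≤ n * Q := by gcongr
  have hs : ((y + 1 : ℕ) : ℝ) ^ (-(1 - 2 * δ)) ≤ Q := by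
    calc ((y + 1 : ℕ) : ℝ) ^ (-(1 - 2 * δ)) ≤ Real.exp R ^ (-(1 - 2 * δ)) :=
          Real.rpow_le_rpow_of_nonpos (Real.exp_pos _) hylt.le (by linarith)
      _ = Q := by rw [← Real.exp_mul, hQ, mul_comm]
  have hc : 0 ≤ (1 + 2 / δ) * zetaAt δ := mul_nonneg (by positivity) (zetaAt_nonneg δ)
  -- Here `W = 1 + log n`, so `1 + 2 * log n` is `2 * W - 1`, and `L` is `lam ^ 3`.
  have herr := error_terms_le hA hn0.le (by linarith : 1 ≤ 1 + x) (Real.exp_pos _).le hU1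
    (one_le_pow₀ hlam1) (h.pow_mul_pow_le hδ0 hδ1) hr hv hs hc
  rw [hM]
  refine (hmain.trans (le_of_eq ?_)).trans herr
  ring

/-- A bound that is good enough for small `n`. -/
theorem abs_sum_sub_const_le_trivial {f : ℕ → ℕ → ℝ} {A : ℝ}
    (hb : ∀ a n : ℕ, 1 ≤ a → a ≤ n → |f a n| ≤ A * (1 + Real.log ((n : ℝ) / (a : ℝ)))) (n : ℕ) :
    |∑ a ∈ Icc 1 n, f a n - (n : ℝ) * seriesConst f| ≤
      A * n * (1 + Real.log n + 9 * zetaAt (1 / 4)) := by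
  have hA := nonneg_of_bound hb
  have h1 : |∑ a ∈ Icc 1 n, f a n| ≤ n * (A * (1 + Real.log n)) := by
    calc _ ≤ ∑ a ∈ Icc 1 n, |f a n| := abs_sum_le_sum_abs _ _
      _ ≤ ∑ a ∈ Icc 1 n, A * (1 + Real.log n) :=
          sum_le_sum fun a ha => abs_le_log hb (mem_Icc.mp ha).1 (mem_Icc.mp ha).2
      _ = _ := by rw [sum_const, Nat.card_Icc, nsmul_eq_mul, Nat.add_sub_cancel]
  have h2 : |seriesConst f| ≤ A * (9 * zetaAt (1 / 4)) := by
    -- With `y = 0` the tail estimate bounds the whole series; the constant `9` is `1 + 2 / δ` at `δ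
    -- = 1 / 4`.
    have h := abs_tsum_sub_sum_Icc_le (δ := 1 / 4) (by norm_num) le_rfl
      (g := fun i => ∑' d : Nat.smoothNumbers (i + 1), seriesTerm f i d) hA
      (fun i hi => abs_tsum_seriesTerm_le hb hi) 0
    simp only [Icc_eq_empty_of_lt zero_lt_one, sum_empty, sub_zero, zero_add, Nat.cast_one,
      Real.one_rpow, mul_one] at h
    calc _ ≤ _ := h
      _ = _ := by norm_num; ring
  calc _ ≤ |∑ a ∈ Icc 1 n, f a n| + |(n : ℝ) * seriesConst f| := abs_sub _ _
    _ ≤ n * (A * (1 + Real.log n)) + n * (A * (9 * zetaAt (1 / 4))) := by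
        rw [abs_mul, Nat.abs_cast]
        gcongr
    _ = _ := by ring

theorem rate_le_self {x : ℝ} (hx : 0 < x) : rate x ≤ x := by
  rw [rate, Real.sqrt_le_iff]
  have := Real.log_le_sub_one_of_pos hx
  exact ⟨hx.le, by nlinarith⟩

end DivLcm

/-! ### The theorem: large `n` by the estimate above, small `n` by the constant. -/

open DivLcm in
theorem theorem5p2 (ε : ℝ) (hε : 0 < ε) :
    ∃ K : ℝ, ∀ (A : ℝ) (f : ℕ → ℕ → ℝ),
      (DivLcm.DependsOnlyOnComponent DivLcm.divisorGraph f ∨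
        DivLcm.DependsOnlyOnComponent DivLcm.lcmGraph f) →
      (∀ a n : ℕ, 1 ≤ a → a ≤ n → |f a n| ≤ A * (1 + Real.log ((n : ℝ) / (a : ℝ)))) →
      (∀ i : ℕ+, Summable
        (fun d : Nat.smoothNumbers ((i : ℕ) + 1) => DivLcm.seriesTerm f (i : ℕ) (d : ℕ))) ∧
      Summable (fun i : ℕ+ =>
        ∑' d : Nat.smoothNumbers ((i : ℕ) + 1), DivLcm.seriesTerm f (i : ℕ) (d : ℕ)) ∧
      ∀ n : ℕ, 3 ≤ n →
        |∑ a ∈ Finset.Icc 1 n, f a n - (n : ℝ) * DivLcm.seriesConst f| ≤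
          K * (A * (n : ℝ) * Real.exp (-(1 - ε) *
            Real.sqrt (Real.log (n : ℝ) * Real.log (Real.log (n : ℝ))))) := by
  obtain ⟨δ, hδ0, hδ1, hδε⟩ : ∃ δ : ℝ, 0 < δ ∧ δ ≤ 1 / 4 ∧ 6 * δ ≤ ε :=
    ⟨min (1 / 4) (ε / 6), lt_min (by norm_num) (by positivity), min_le_left _ _,
      by linarith [min_le_right (1 / 4) (ε / 6)]⟩
  obtain ⟨N, hN⟩ := Filter.eventually_atTop.mp
    ((Real.tendsto_log_atTop.comp tendsto_natCast_atTop_atTop).eventually (eventually_largeLog hδ0))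
  have hζ := zetaAt_nonneg δ
  have hζ' := zetaAt_nonneg (1 / 4)
  set K₁ := 12 + (1 + 2 / δ) * zetaAt δ with hK₁
  -- `K₂` takes care of the finitely many `n < N`, with `N` depending only on `δ`. The absolute
  -- value covers `ε > 1` as well.
  set K₂ := (1 + N + 9 * zetaAt (1 / 4)) * Real.exp (|1 - ε| * N) with hK₂
  have hK₁0 : 0 ≤ K₁ := by positivity
  have hK₂0 : 0 ≤ K₂ := by positivity
  refine ⟨K₁ + K₂, fun A f hf hb => ⟨fun i => summable_seriesTerm hb i.2, ?_, fun n hn => ?_⟩⟩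
  · exact (summable_pnat_iff_summable_succ
      (f := fun i : ℕ => ∑' d : Nat.smoothNumbers (i + 1), seriesTerm f i d)).mpr
      (summable_of_log_div_sq (nonneg_of_bound hb) fun i hi => abs_tsum_seriesTerm_le hb hi)
  have hA := nonneg_of_bound hb
  have hn3 : (3 : ℝ) ≤ n := by exact_mod_cast hn
  have hR := rate_nonneg (Real.log n)
  change _ ≤ (K₁ + K₂) * (A * (n : ℝ) * Real.exp (-(1 - ε) * rate (Real.log n)))
  rw [add_mul]
  rcases le_or_gt N n with hNn | hNn
  · have h := abs_sum_sub_const_le_of_largeLog hf hb hδ0 hδ1 (by omega) (hN n hNn)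
    have h1 : Real.exp (-(1 - 6 * δ) * rate (Real.log n)) ≤
        Real.exp (-(1 - ε) * rate (Real.log n)) := Real.exp_le_exp.mpr (by nlinarith)
    have h2 : K₁ * (A * n * Real.exp (-(1 - 6 * δ) * rate (Real.log n))) ≤
        K₁ * (A * n * Real.exp (-(1 - ε) * rate (Real.log n))) := by gcongr
    have h3 : 0 ≤ K₂ * (A * n * Real.exp (-(1 - ε) * rate (Real.log n))) := by positivity
    linarith
  · have h := abs_sum_sub_const_le_trivial hb n
    have hnN : (n : ℝ) ≤ N := by exact_mod_cast hNn.le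
    have hlog : Real.log n ≤ N := by
      linarith [Real.log_le_sub_one_of_pos (show (0 : ℝ) < n by linarith)]
    have hrate : rate (Real.log n) ≤ N := (rate_le_self (Real.log_pos (by linarith))).trans hlog
    have h1 : 1 ≤ Real.exp (|1 - ε| * N) * Real.exp (-(1 - ε) * rate (Real.log n)) := by
      rw [← Real.exp_add]
      refine Real.one_le_exp ?_
      have h2 : (1 - ε) * rate (Real.log n) ≤ |1 - ε| * N :=
        mul_le_mul (le_abs_self _) hrate hR (abs_nonneg _)
      linarith
    have h3 : 0 ≤ K₁ * (A * n * Real.exp (-(1 - ε) * rate (Real.log n))) := by positivity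
    calc _ ≤ A * n * (1 + Real.log n + 9 * zetaAt (1 / 4)) := h
      _ ≤ A * n * (1 + N + 9 * zetaAt (1 / 4)) * 1 := by rw [mul_one]; gcongr
      _ ≤ A * n * (1 + N + 9 * zetaAt (1 / 4)) *
          (Real.exp (|1 - ε| * N) * Real.exp (-(1 - ε) * rate (Real.log n))) := by gcongr
      _ = K₂ * (A * n * Real.exp (-(1 - ε) * rate (Real.log n))) := by rw [hK₂]; ring
      _ ≤ _ := by linarith
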